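/- A \emph{CQG-algebra} is a complex Hopf $*$-algebra which is spanned by the coefficients of its finite-dimensional unitary corepresentations; a compact quantum group $\mathbb{G}$ is given by its CQG-algebra $\mathcal{O}(\mathbb{G})$. We write $\mathbb{K}<\mathbb{G}$ ($\mathbb{K}$ is a quantum subgroup of $\mathbb{G}$) if there is a surjective Hopf algebra $*$-homomorphism $\mathcal{O}(\mathbb{G})\to\mathcal{O}(\mathbb{K})$, and $\mathbb{K}\cong\mathbb{G}$ if there is a bijective one. A dual quantum subgroup $\mathbb{H}$ of $\mathbb{G}$ is a compact quantum group together with an inclusion of $\mathcal{O}(\mathbb{H})$ into $\mathcal{O}(\mathbb{G})$ as a Hopf $*$-subalgebra. The direct product $\mathbb{G}\times\mathbb{K}$ has CQG-algebra $\mathcal{O}(\mathbb{G})\otimes\mathcal{O}(\mathbb{K})$. Let $\mathcal{O}(S_N^+)$ be the universal unital $*$-algebra generated by $(p_{ij})_{1\le i,j\le N}$ with $p_{ij}^2=p_{ij}=p_{ij}^*$, $\sum_k p_{ik}=1=\sum_k p_{kj}$, $p_{ik}p_{jk}=\delta_{ij}p_{ik}$ and $p_{ki}p_{kj}=\delta_{ij}p_{ki}$,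 with coproduct $\Delta(p_{ij})=\sum_k p_{ik}\otimes p_{kj}$. The free wreath product with amalgamation $\mathbb{G}\wr_{*,\mathbb{H}}S_N^+$ is the compact quantum group whose CQG-algebra is the quotient of the free product of $\mathcal{O}(S_N^+)$ and of the $N$-fold free product of copies of $\mathcal{O}(\mathbb{G})$ amalgamated over $\mathcal{O}(\mathbb{H})$, by the relations $[\nu_i(x),p_{ij}]=0$ for all $1\le i,j\le N$ and $x\in\mathcal{O}(\mathbb{G})$, where $\nu_i$ is the canonical map of $\mathcal{O}(\mathbb{G})$ to the $i$-th copy; its coproduct is given by $$\Delta(p_{ij})=\sum_{k=1}^N p_{ik}\otimes p_{kj},\qquad \Delta(\nu_i(x))=\sum_{k=1}^N(\nu_i\otimes\nu_k)(\Delta_{\mathbb{G}}(x))(p_{ik}\otimes 1).$$ The free wreath product $\mathbb{G}\wr_* S_N^+$ is defined in the same way with the free product without amalgamation. \textbf{Proposition.} Let $\mathbb{G}$ be a compact quantum group and let $\mathbb{H}$ be a dual quantum subgroup of $\mathbb{G}$. Then, for every integer $N\ge 1$, $$\mathbb{G}\times S_N^+ \;<\; \mathbb{G}\wr_{*,\mathbb{H}}S_N^+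 \;<\; \mathbb{G}\wr_* S_N^+ .$$ Moreover, the construction interpolates between the two extremes: $\mathbb{G}\wr_{*,\mathbb{G}}S_N^+\cong\mathbb{G}\times S_N^+$ for $\mathbb{H}=\mathbb{G}$, and $\mathbb{G}\wr_{*,\{e\}}S_N^+\cong\mathbb{G}\wr_*S_N^+$ for the trivial dual quantum subgroup $\mathbb{C}1\subset\mathcal{O}(\mathbb{G})$. -/

import Mathlib

open scoped TensorProduct

set_option linter.unusedSectionVars false
set_option linter.unusedSimpArgs false

noncomputable section

namespace QuantumWreath

/-! ## CQG-algebras, quantum subgroups and dual quantum subgroups -/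

/-- A Hopf `*`-algebra: a complex Hopf algebra with a conjugate-linear, antimultiplicative
involution for which the coproduct is a `*`-homomorphism. -/
class HopfStarAlgebra (A : Type*) [Ring A] [StarRing A] [HopfAlgebra ℂ A] : Prop
    extends StarModule ℂ A where
  comul_star : ∀ x : A, Coalgebra.comul (R := ℂ) (star x) = star (Coalgebra.comul (R := ℂ) x)

/-- The matrix `u` with entries in the Hopf `*`-algebra `A` is a unitary corepresentation of `A`
(a finite-dimensional unitary representation of the corresponding quantum group). -/
structure IsUnitaryCorep {A : Type*} [Ring A] [StarRing A] [HopfAlgebra ℂ A]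
    {n : Type*} [Fintype n] [DecidableEq n] (u : Matrix n n A) : Prop where
  unitary : u ∈ unitary (Matrix n n A)
  comul : ∀ i j, Coalgebra.comul (R := ℂ) (u i j) = ∑ k, u i k ⊗ₜ[ℂ] u k j

/-- The set of all coefficients of finite-dimensional unitary corepresentations. -/
def matrixCoefficients (A : Type*) [Ring A] [StarRing A] [HopfAlgebra ℂ A] : Set A :=
  {x | ∃ (d : ℕ) (u : Matrix (Fin d) (Fin d) A), IsUnitaryCorep u ∧ ∃ i j, u i j = x}

/-- A CQG-algebra `A = O(G)`: a Hopf `*`-algebra spanned by the coefficients of its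
finite-dimensional unitary corepresentations. A compact quantum group `G` is, by definition,
given by its CQG-algebra `O(G)`. -/
class CQGAlgebra (A : Type*) [Ring A] [StarRing A] [HopfAlgebra ℂ A] : Prop
    extends HopfStarAlgebra A where
  span_matrixCoefficients : Submodule.span ℂ (matrixCoefficients A) = ⊤

/-- `IsQuantumSubgroup OH OG` says that the compact quantum group with CQG-algebra `OH` is a
quantum subgroup of the one with CQG-algebra `OG`, that is, there is a surjective Hopf algebra
`*`-homomorphism `OG → OH`. (A bialgebra homomorphism between Hopf algebras automatically
intertwines the antipodes.) -/
def IsQuantumSubgroup (OH OG : Type*)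
    [Ring OH] [StarRing OH] [HopfAlgebra ℂ OH] [CQGAlgebra OH]
    [Ring OG] [StarRing OG] [HopfAlgebra ℂ OG] [CQGAlgebra OG] : Prop :=
  ∃ π : OG →ₐc[ℂ] OH, (∀ x, π (star x) = star (π x)) ∧ Function.Surjective π

/-- Two compact quantum groups are isomorphic if there is a bijective Hopf algebra
`*`-homomorphism between their CQG-algebras. -/
def IsIsomorphic (OG OH : Type*)
    [Ring OG] [StarRing OG] [HopfAlgebra ℂ OG] [CQGAlgebra OG]
    [Ring OH] [StarRing OH] [HopfAlgebra ℂ OH] [CQGAlgebra OH] : Prop :=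
  ∃ φ : OG →ₐc[ℂ] OH, (∀ x, φ (star x) = star (φ x)) ∧ Function.Bijective φ

/-- `DualQuantumSubgroup OH OG`: a realization of the CQG-algebra `OH` as a Hopf `*`-subalgebra
of the CQG-algebra `OG`, i.e. an injective Hopf algebra `*`-homomorphism `OH → OG`. -/
structure DualQuantumSubgroup (OH OG : Type*)
    [Ring OH] [StarRing OH] [HopfAlgebra ℂ OH] [CQGAlgebra OH]
    [Ring OG] [StarRing OG] [HopfAlgebra ℂ OG] [CQGAlgebra OG] where
  incl : OH →ₐc[ℂ] OG
  incl_star : ∀ x, incl (star x) = star (incl x)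
  injective : Function.Injective incl

/-! ## Tools for constructing Hopf `*`-algebras from generators -/

section Tools

/-- The opposite algebra with the conjugate scalar multiplication: algebra homomorphisms into it
are conjugate-linear antihomomorphisms. -/
def ConjOp (B : Type*) : Type _ := Bᵐᵒᵖ

instance (B : Type*) [Ring B] : Ring (ConjOp B) := inferInstanceAs (Ring Bᵐᵒᵖ)

instance (B : Type*) [Ring B] [Algebra ℂ B] : Algebra ℂ (ConjOp B) :=
  RingHom.toAlgebra' ((algebraMap ℂ Bᵐᵒᵖ).comp (starRingEnd ℂ))
    (fun c x => Algebra.commutes (A := Bᵐᵒᵖ) (starRingEnd ℂ c) x)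

def ConjOp.to {B : Type*} (b : B) : ConjOp B := MulOpposite.op b
def ConjOp.of {B : Type*} (b : ConjOp B) : B := MulOpposite.unop b

section
variable {B : Type*} [Ring B] [Algebra ℂ B]

@[simp] lemma ConjOp.of_to (b : B) : ConjOp.of (ConjOp.to b) = b := rfl
@[simp] lemma ConjOp.to_of (b : ConjOp B) : ConjOp.to (ConjOp.of b) = b := rfl
@[simp] lemma ConjOp.of_mul (x y : ConjOp B) : (x * y).of = y.of * x.of := rfl
@[simp] lemma ConjOp.of_add (x y : ConjOp B) : (x + y).of = x.of + y.of := rfl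
@[simp] lemma ConjOp.of_one : (1 : ConjOp B).of = 1 := rfl
@[simp] lemma ConjOp.of_zero : (0 : ConjOp B).of = 0 := rfl
@[simp] lemma ConjOp.of_algebraMap (c : ℂ) :
    (algebraMap ℂ (ConjOp B) c).of = algebraMap ℂ B (star c) := rfl
@[simp] lemma ConjOp.to_mul (x y : B) : ConjOp.to (x * y) = ConjOp.to y * ConjOp.to x := rfl
@[simp] lemma ConjOp.to_add (x y : B) : ConjOp.to (x + y) = ConjOp.to x + ConjOp.to y := rfl
@[simp] lemma ConjOp.to_one : ConjOp.to (1 : B) = 1 := rfl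
@[simp] lemma ConjOp.to_zero : ConjOp.to (0 : B) = 0 := rfl
@[simp] lemma ConjOp.to_algebraMap (c : ℂ) :
    ConjOp.to (algebraMap ℂ B c) = algebraMap ℂ (ConjOp B) (star c) := by
  change _ = MulOpposite.op (algebraMap ℂ B (star (star c)))
  rw [star_star]; rfl
lemma ConjOp.to_sum {κ : Type*} (s : Finset κ) (f : κ → B) :
    ConjOp.to (∑ i ∈ s, f i) = ∑ i ∈ s, ConjOp.to (f i) :=
  map_sum ({ toFun := ConjOp.to, map_zero' := rfl, map_add' := fun _ _ => rfl } :
    B →+ ConjOp B) f s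
lemma ConjOp.to_injective : Function.Injective (ConjOp.to (B := B)) :=
  fun _ _ h => congrArg ConjOp.of h

/-- For a `*`-algebra, the involution as an algebra homomorphism to `ConjOp`. -/
def starToConjOp (B : Type*) [Ring B] [Algebra ℂ B] [StarRing B] [StarModule ℂ B] :
    B →ₐ[ℂ] ConjOp B where
  toFun x := ConjOp.to (star x)
  map_one' := by simp
  map_mul' x y := by simp
  map_zero' := by simp
  map_add' x y := by simp
  commutes' c := by
    change ConjOp.to (star (algebraMap ℂ B c)) = _
    rw [← algebraMap_star_comm, ConjOp.to_algebraMap, star_star]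

end

variable {Q : Type*} [Ring Q]

/-- The involution determined by an algebra homomorphism `Q → ConjOp Q` which is involutive on a
generating set. -/
@[reducible] def starRingOfHom [Algebra ℂ Q] (f : Q →ₐ[ℂ] ConjOp Q) (s : Set Q)
    (hs : Algebra.adjoin ℂ s = ⊤) (hf : ∀ x ∈ s, (f (f x).of).of = x) : StarRing Q where
  star x := (f x).of
  star_involutive x := by
    have hx : x ∈ Algebra.adjoin ℂ s := hs ▸ Algebra.mem_top
    change (f (f x).of).of = x
    induction hx using Algebra.adjoin_induction with
    | mem x hx => exact hf x hx
    | algebraMap c => simp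
    | add x y _ _ hx hy => simp [hx, hy]
    | mul x y _ _ hx hy => simp [hx, hy]
  star_mul x y := by change (f (x * y)).of = _; simp
  star_add x y := by change (f (x + y)).of = _; simp

lemma starModuleOfHom [Algebra ℂ Q] (f : Q →ₐ[ℂ] ConjOp Q) (s : Set Q)
    (hs : Algebra.adjoin ℂ s = ⊤) (hf : ∀ x ∈ s, (f (f x).of).of = x) :
    let := starRingOfHom f s hs hf
    StarModule ℂ Q := by
  let := starRingOfHom f s hs hf
  constructor
  intro c x
  change (f (c • x)).of = star c • (f x).of
  rw [Algebra.smul_def, map_mul, AlgHom.commutes, ConjOp.of_mul, ConjOp.of_algebraMap,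
    Algebra.smul_def, Algebra.commutes]

lemma antipode_left_mul [Algebra ℂ Q] (S : Q →ₐ[ℂ] Qᵐᵒᵖ) (u t : Q ⊗[ℂ] Q) (c : ℂ)
    (hu : LinearMap.mul' ℂ Q (((MulOpposite.opLinearEquiv ℂ).symm.toLinearMap ∘ₗ
      S.toLinearMap).rTensor Q u) = algebraMap ℂ Q c) :
    LinearMap.mul' ℂ Q (((MulOpposite.opLinearEquiv ℂ).symm.toLinearMap ∘ₗ
      S.toLinearMap).rTensor Q (u * t)) = c • LinearMap.mul' ℂ Q
        (((MulOpposite.opLinearEquiv ℂ).symm.toLinearMap ∘ₗ S.toLinearMap).rTensor Q t) := by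
  induction t with
  | zero => simp
  | add a b ha hb => rw [mul_add, map_add, map_add, ha, hb, map_add, map_add, smul_add]
  | tmul y z =>
    have key : ∀ u : Q ⊗[ℂ] Q, LinearMap.mul' ℂ Q (((MulOpposite.opLinearEquiv ℂ).symm.toLinearMap
        ∘ₗ S.toLinearMap).rTensor Q (u * (y ⊗ₜ z))) = (S y).unop * LinearMap.mul' ℂ Q
        (((MulOpposite.opLinearEquiv ℂ).symm.toLinearMap ∘ₗ S.toLinearMap).rTensor Q u) * z := by
      intro u
      induction u with
      | zero => simp
      | add a b ha hb => rw [add_mul, map_add, map_add, ha, hb, map_add, map_add, mul_add, add_mul]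
      | tmul a b => simp [mul_assoc]
    rw [key, hu]
    simp [Algebra.algebraMap_eq_smul_one]

lemma antipode_right_mul [Algebra ℂ Q] (S : Q →ₐ[ℂ] Qᵐᵒᵖ) (u t : Q ⊗[ℂ] Q) (c : ℂ)
    (ht : LinearMap.mul' ℂ Q (((MulOpposite.opLinearEquiv ℂ).symm.toLinearMap ∘ₗ
      S.toLinearMap).lTensor Q t) = algebraMap ℂ Q c) :
    LinearMap.mul' ℂ Q (((MulOpposite.opLinearEquiv ℂ).symm.toLinearMap ∘ₗ
      S.toLinearMap).lTensor Q (u * t)) = c • LinearMap.mul' ℂ Q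
        (((MulOpposite.opLinearEquiv ℂ).symm.toLinearMap ∘ₗ S.toLinearMap).lTensor Q u) := by
  induction u with
  | zero => simp
  | add a b ha hb => rw [add_mul, map_add, map_add, ha, hb, map_add, map_add, smul_add]
  | tmul y z =>
    have key : ∀ t : Q ⊗[ℂ] Q, LinearMap.mul' ℂ Q (((MulOpposite.opLinearEquiv ℂ).symm.toLinearMap
        ∘ₗ S.toLinearMap).lTensor Q ((y ⊗ₜ z) * t)) = y * LinearMap.mul' ℂ Q
        (((MulOpposite.opLinearEquiv ℂ).symm.toLinearMap ∘ₗ S.toLinearMap).lTensor Q t) *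
          (S z).unop := by
      intro t
      induction t with
      | zero => simp
      | add a b ha hb => rw [mul_add, map_add, map_add, ha, hb, map_add, map_add, mul_add, add_mul]
      | tmul a b => simp [mul_assoc]
    rw [key, ht]
    simp [Algebra.algebraMap_eq_smul_one]

/-- A Hopf algebra structure from an antihomomorphism satisfying the antipode axioms on a
generating set. -/
@[reducible] def hopfOfAntiHom [Bialgebra ℂ Q] (S : Q →ₐ[ℂ] Qᵐᵒᵖ) (s : Set Q)
    (hs : Algebra.adjoin ℂ s = ⊤)
    (hl : ∀ x ∈ s, LinearMap.mul' ℂ Q (((MulOpposite.opLinearEquiv ℂ).symm.toLinearMap ∘ₗ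
      S.toLinearMap).rTensor Q (Coalgebra.comul x)) = algebraMap ℂ Q (Coalgebra.counit x))
    (hr : ∀ x ∈ s, LinearMap.mul' ℂ Q (((MulOpposite.opLinearEquiv ℂ).symm.toLinearMap ∘ₗ
      S.toLinearMap).lTensor Q (Coalgebra.comul x)) = algebraMap ℂ Q (Coalgebra.counit x)) :
    HopfAlgebra ℂ Q where
  antipode := (MulOpposite.opLinearEquiv ℂ).symm.toLinearMap ∘ₗ S.toLinearMap
  mul_antipode_rTensor_comul := by
    ext x
    have hx : x ∈ Algebra.adjoin ℂ s := hs ▸ Algebra.mem_top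
    change LinearMap.mul' ℂ Q (((MulOpposite.opLinearEquiv ℂ).symm.toLinearMap ∘ₗ
      S.toLinearMap).rTensor Q (Coalgebra.comul x)) = algebraMap ℂ Q (Coalgebra.counit x)
    induction hx using Algebra.adjoin_induction with
    | mem x hx => exact hl x hx
    | algebraMap c =>
      simp [Bialgebra.comul_algebraMap, Algebra.TensorProduct.algebraMap_apply]
    | add x y _ _ hx hy => simp only [map_add, hx, hy]
    | mul x y _ _ hx hy =>
      rw [Bialgebra.comul_mul, antipode_left_mul S _ _ _ hx, hy, Bialgebra.counit_mul, map_mul,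
        Algebra.smul_def]
  mul_antipode_lTensor_comul := by
    ext x
    have hx : x ∈ Algebra.adjoin ℂ s := hs ▸ Algebra.mem_top
    change LinearMap.mul' ℂ Q (((MulOpposite.opLinearEquiv ℂ).symm.toLinearMap ∘ₗ
      S.toLinearMap).lTensor Q (Coalgebra.comul x)) = algebraMap ℂ Q (Coalgebra.counit x)
    induction hx using Algebra.adjoin_induction with
    | mem x hx => exact hr x hx
    | algebraMap c =>
      simp [Bialgebra.comul_algebraMap, Algebra.TensorProduct.algebraMap_apply]
    | add x y _ _ hx hy => simp only [map_add, hx, hy]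
    | mul x y _ _ hx hy =>
      rw [Bialgebra.comul_mul, antipode_right_mul S _ _ _ hy, hx, Bialgebra.counit_mul, map_mul,
        Algebra.smul_def, Algebra.commutes]

lemma hopfStarOfAdjoin [StarRing Q] [HopfAlgebra ℂ Q] [StarModule ℂ Q] (s : Set Q)
    (hs : Algebra.adjoin ℂ s = ⊤)
    (h : ∀ x ∈ s, Coalgebra.comul (R := ℂ) (star x) = star (Coalgebra.comul (R := ℂ) x)) :
    HopfStarAlgebra Q where
  comul_star x := by
    have hx : x ∈ Algebra.adjoin ℂ s := hs ▸ Algebra.mem_top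
    induction hx using Algebra.adjoin_induction with
    | mem x hx => exact h x hx
    | algebraMap c =>
      rw [← algebraMap_star_comm, Bialgebra.comul_algebraMap, Bialgebra.comul_algebraMap,
        algebraMap_star_comm]
    | add x y _ _ hx hy => simp only [map_add, star_add, hx, hy]
    | mul x y _ _ hx hy => rw [star_mul, Bialgebra.comul_mul, hx, hy, Bialgebra.comul_mul, star_mul]

lemma IsUnitaryCorep.mem_matrixCoefficients [StarRing Q] [HopfAlgebra ℂ Q]
    {n : Type*} [Fintype n] [DecidableEq n] {u : Matrix n n Q} (hu : IsUnitaryCorep u) (i j : n) :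
    u i j ∈ matrixCoefficients Q := by
  let e := Fintype.equivFin n
  refine ⟨Fintype.card n, u.submatrix e.symm e.symm, ⟨?_, ?_⟩, e i, e j, by simp⟩
  · have h := hu.unitary
    rw [Unitary.mem_iff] at h ⊢
    rw [Matrix.star_eq_conjTranspose] at h ⊢
    rw [Matrix.conjTranspose_submatrix, Matrix.submatrix_mul_equiv, Matrix.submatrix_mul_equiv,
      h.1, h.2]
    simp
  · intro a b
    rw [Matrix.submatrix_apply, hu.comul]
    exact (Equiv.sum_comp e.symm (fun k => u (e.symm a) k ⊗ₜ[ℂ] u k (e.symm b))).symm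

lemma one_mem_matrixCoefficients [StarRing Q] [HopfAlgebra ℂ Q] :
    (1 : Q) ∈ matrixCoefficients Q := by
  have : IsUnitaryCorep (1 : Matrix Unit Unit Q) :=
    ⟨one_mem _, fun i j => by simp [Algebra.TensorProduct.one_def]⟩
  simpa using this.mem_matrixCoefficients () ()

lemma isUnitaryCorep_iff_sums [StarRing Q] [HopfAlgebra ℂ Q]
    {n : Type*} [Fintype n] [DecidableEq n] (u : Matrix n n Q) :
    u ∈ unitary (Matrix n n Q) ↔
      (∀ i j, ∑ k, star (u k i) * u k j = if i = j then 1 else 0) ∧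
      (∀ i j, ∑ k, u i k * star (u j k) = if i = j then 1 else 0) := by
  rw [Unitary.mem_iff, ← Matrix.ext_iff, ← Matrix.ext_iff]
  simp only [Matrix.mul_apply, Matrix.star_apply, Matrix.one_apply]

lemma mul_mem_matrixCoefficients [StarRing Q] [HopfAlgebra ℂ Q] {x y : Q}
    (hx : x ∈ matrixCoefficients Q) (hy : y ∈ matrixCoefficients Q) :
    x * y ∈ matrixCoefficients Q := by
  obtain ⟨d, u, hu, i, j, rfl⟩ := hx
  obtain ⟨e, v, hv, k, l, rfl⟩ := hy
  have h1 := (isUnitaryCorep_iff_sums u).1 hu.unitary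
  have h2 := (isUnitaryCorep_iff_sums v).1 hv.unitary
  let w : Matrix (Fin d × Fin e) (Fin d × Fin e) Q := fun a b => u a.1 b.1 * v a.2 b.2
  have hw : IsUnitaryCorep w := by
    refine ⟨(isUnitaryCorep_iff_sums w).2 ⟨?_, ?_⟩, ?_⟩
    · rintro ⟨a, b⟩ ⟨a', b'⟩
      have : ∀ p : Fin e, ∑ q : Fin d, star (u q a * v p b) * (u q a' * v p b') =
          star (v p b) * (∑ q, star (u q a) * u q a') * v p b' := by
        intro p
        simp only [Finset.mul_sum, Finset.sum_mul, star_mul, mul_assoc]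
      rw [Fintype.sum_prod_type_right]
      simp only [w, this, h1.1]
      by_cases ha : a = a'
      · simp [ha, h2.1]
      · simp [ha]
    · rintro ⟨a, b⟩ ⟨a', b'⟩
      have : ∀ p : Fin d, ∑ q : Fin e, (u a p * v b q) * star (u a' p * v b' q) =
          u a p * (∑ q, v b q * star (v b' q)) * star (u a' p) := by
        intro p
        simp only [Finset.mul_sum, Finset.sum_mul, star_mul, mul_assoc]
      rw [Fintype.sum_prod_type]
      simp only [w, this, h2.2]
      by_cases hb : b = b'
      · simp [hb, h1.2]
      · simp [hb]
    · rintro ⟨a, b⟩ ⟨a', b'⟩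
      simp only [w, Bialgebra.comul_mul, hu.comul, hv.comul, Finset.sum_mul_sum,
        Fintype.sum_prod_type, Algebra.TensorProduct.tmul_mul_tmul]
  exact hw.mem_matrixCoefficients (i, k) (j, l)

lemma cqgOfAdjoin [StarRing Q] [HopfAlgebra ℂ Q] [HopfStarAlgebra Q] (s : Set Q)
    (hs : Algebra.adjoin ℂ s = ⊤)
    (h : ∀ x ∈ s, x ∈ Submodule.span ℂ (matrixCoefficients Q)) : CQGAlgebra Q where
  span_matrixCoefficients := by
    rw [eq_top_iff]
    intro x _
    have hx : x ∈ Algebra.adjoin ℂ s := hs ▸ Algebra.mem_top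
    induction hx using Algebra.adjoin_induction with
    | mem x hx => exact h x hx
    | algebraMap c =>
      rw [Algebra.algebraMap_eq_smul_one]
      exact Submodule.smul_mem _ _ (Submodule.subset_span one_mem_matrixCoefficients)
    | add x y _ _ hx hy => exact add_mem (hx trivial) (hy trivial)
    | mul x y _ _ hx hy =>
      have := Submodule.mul_mem_mul (hx trivial) (hy trivial)
      rw [Submodule.span_mul_span] at this
      refine Submodule.span_mono ?_ this
      rintro _ ⟨a, ha, b, hb, rfl⟩
      exact mul_mem_matrixCoefficients ha hb

end Tools

/-! ## The trivial group and direct products -/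

section Basic

/-- The CQG-algebra of the trivial quantum group is `ℂ`. -/
instance : CQGAlgebra ℂ :=
  haveI : HopfStarAlgebra ℂ := hopfStarOfAdjoin (∅ : Set ℂ)
    (eq_top_iff.2 fun x _ => Subalgebra.algebraMap_mem (Algebra.adjoin ℂ (∅ : Set ℂ)) x)
    (fun _ hx => hx.elim)
  cqgOfAdjoin (∅ : Set ℂ)
    (eq_top_iff.2 fun x _ => Subalgebra.algebraMap_mem (Algebra.adjoin ℂ (∅ : Set ℂ)) x)
    (fun _ hx => hx.elim)

variable {A B : Type*} [Ring A] [StarRing A] [HopfAlgebra ℂ A]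
  [Ring B] [StarRing B] [HopfAlgebra ℂ B]

lemma adjoin_tensor : Algebra.adjoin ℂ
    (Set.range (fun a : A => a ⊗ₜ[ℂ] (1 : B)) ∪ Set.range (fun b : B => (1 : A) ⊗ₜ[ℂ] b)) = ⊤ := by
  rw [eq_top_iff]
  intro x _
  induction x with
  | zero => exact zero_mem _
  | add x y hx hy => exact add_mem (hx trivial) (hy trivial)
  | tmul a b =>
    have : a ⊗ₜ[ℂ] b = (a ⊗ₜ[ℂ] (1 : B)) * ((1 : A) ⊗ₜ[ℂ] b) := by simp
    rw [this]
    exact mul_mem (Algebra.subset_adjoin (Or.inl ⟨a, rfl⟩)) (Algebra.subset_adjoin (Or.inr ⟨b, rfl⟩))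

lemma comul_tmul_one (a : A) : Coalgebra.comul (R := ℂ) (a ⊗ₜ[ℂ] (1 : B)) =
    Algebra.TensorProduct.map (Algebra.TensorProduct.includeLeft : A →ₐ[ℂ] A ⊗[ℂ] B)
      (Algebra.TensorProduct.includeLeft : A →ₐ[ℂ] A ⊗[ℂ] B) (Coalgebra.comul (R := ℂ) a) := by
  rw [TensorProduct.comul_tmul, Bialgebra.comul_one]
  generalize Coalgebra.comul (R := ℂ) a = t
  induction t with
  | zero => simp
  | add x y hx hy => rw [TensorProduct.add_tmul, map_add, map_add, hx, hy]
  | tmul x y => simp [Algebra.TensorProduct.one_def]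

lemma comul_one_tmul (b : B) : Coalgebra.comul (R := ℂ) ((1 : A) ⊗ₜ[ℂ] b) =
    Algebra.TensorProduct.map (Algebra.TensorProduct.includeRight : B →ₐ[ℂ] A ⊗[ℂ] B)
      (Algebra.TensorProduct.includeRight : B →ₐ[ℂ] A ⊗[ℂ] B) (Coalgebra.comul (R := ℂ) b) := by
  rw [TensorProduct.comul_tmul, Bialgebra.comul_one]
  generalize Coalgebra.comul (R := ℂ) b = t
  induction t with
  | zero => simp
  | add x y hx hy => rw [TensorProduct.tmul_add, map_add, map_add, hx, hy]
  | tmul x y => simp [Algebra.TensorProduct.one_def]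

lemma starHom_map_star {C D : Type*} [Ring C] [StarRing C] [Algebra ℂ C] [StarModule ℂ C]
    [Ring D] [StarRing D] [Algebra ℂ D] [StarModule ℂ D] (f g : C →ₐ[ℂ] D)
    (hf : ∀ x, f (star x) = star (f x)) (hg : ∀ x, g (star x) = star (g x)) (t : C ⊗[ℂ] C) :
    Algebra.TensorProduct.map f g (star t) = star (Algebra.TensorProduct.map f g t) := by
  induction t with
  | zero => simp
  | add x y hx hy => simp only [star_add, map_add, hx, hy]
  | tmul x y => simp [hf, hg]

/-- A `*`-homomorphism compatible with coproducts sends coefficients to coefficients. -/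
lemma map_mem_matrixCoefficients (f : A →ₐ[ℂ] B) (hf : ∀ x, f (star x) = star (f x))
    (hc : ∀ x, Coalgebra.comul (R := ℂ) (f x) =
      Algebra.TensorProduct.map f f (Coalgebra.comul (R := ℂ) x)) {x : A}
    (hx : x ∈ matrixCoefficients A) : f x ∈ matrixCoefficients B := by
  obtain ⟨d, u, hu, i, j, rfl⟩ := hx
  have h := (isUnitaryCorep_iff_sums u).1 hu.unitary
  have : IsUnitaryCorep (fun i j => f (u i j) : Matrix (Fin d) (Fin d) B) := by
    refine ⟨(isUnitaryCorep_iff_sums _).2 ⟨fun i j => ?_, fun i j => ?_⟩, fun i j => ?_⟩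
    · simp only [← hf, ← map_mul, ← map_sum, h.1]
      split_ifs <;> simp
    · simp only [← hf, ← map_mul, ← map_sum, h.2]
      split_ifs <;> simp
    · simp [hc, hu.comul]
  exact this.mem_matrixCoefficients i j

lemma map_mem_span_matrixCoefficients [CQGAlgebra A] (f : A →ₐ[ℂ] B)
    (hf : ∀ x, f (star x) = star (f x))
    (hc : ∀ x, Coalgebra.comul (R := ℂ) (f x) =
      Algebra.TensorProduct.map f f (Coalgebra.comul (R := ℂ) x)) (x : A) :
    f x ∈ Submodule.span ℂ (matrixCoefficients B) := by
  have hx : x ∈ Submodule.span ℂ (matrixCoefficients A) :=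
    CQGAlgebra.span_matrixCoefficients (A := A) ▸ Submodule.mem_top
  induction hx using Submodule.span_induction with
  | mem x hx => exact Submodule.subset_span (map_mem_matrixCoefficients f hf hc hx)
  | zero => simp
  | add x y _ _ hx hy => rw [map_add]; exact add_mem hx hy
  | smul c x _ hx => rw [map_smul]; exact Submodule.smul_mem _ _ hx

instance [HopfStarAlgebra A] [HopfStarAlgebra B] : HopfStarAlgebra (A ⊗[ℂ] B) :=
  hopfStarOfAdjoin _ adjoin_tensor (by
    rintro _ (⟨a, rfl⟩ | ⟨b, rfl⟩)
    · simp only [TensorProduct.star_tmul, star_one, comul_tmul_one, HopfStarAlgebra.comul_star]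
      exact starHom_map_star _ _ (by simp) (by simp) _
    · simp only [TensorProduct.star_tmul, star_one, comul_one_tmul, HopfStarAlgebra.comul_star]
      exact starHom_map_star _ _ (by simp) (by simp) _)

/-- The direct product `G × H` of compact quantum groups has the CQG-algebra `O(G) ⊗ O(H)`, with
the tensor product Hopf `*`-algebra structure. -/
instance [CQGAlgebra A] [CQGAlgebra B] : CQGAlgebra (A ⊗[ℂ] B) :=
  cqgOfAdjoin _ adjoin_tensor (by
    rintro _ (⟨a, rfl⟩ | ⟨b, rfl⟩)
    · exact map_mem_span_matrixCoefficients
        (Algebra.TensorProduct.includeLeft : A →ₐ[ℂ] A ⊗[ℂ] B) (by simp)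
        (fun x => by simpa using comul_tmul_one x) a
    · exact map_mem_span_matrixCoefficients
        (Algebra.TensorProduct.includeRight : B →ₐ[ℂ] A ⊗[ℂ] B) (by simp)
        (fun x => by simpa using comul_one_tmul x) b)

/-- Bialgebra homomorphisms intertwine the antipodes. -/
lemma map_antipode (f : B →ₐc[ℂ] A) (x : B) :
    f (HopfAlgebra.antipode ℂ x) = HopfAlgebra.antipode ℂ (f x) := by
  have h1 : WithConv.toConv ((f : B →ₐ[ℂ] A).toLinearMap ∘ₗ HopfAlgebra.antipode ℂ) *
      WithConv.toConv ((f : B →ₐ[ℂ] A).toLinearMap) = 1 := by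
    ext x
    have h := congrArg f 
      (HopfAlgebra.sum_antipode_mul_eq_algebraMap_counit (Coalgebra.Repr.arbitrary ℂ x))
    have hc : f (algebraMap ℂ B (Coalgebra.counit x)) = algebraMap ℂ A (Coalgebra.counit x) :=
      AlgHomClass.commutes f _
    rw [hc] at h
    rw [(Coalgebra.Repr.arbitrary ℂ x).convMul_apply]
    simpa using h
  have h2 : WithConv.toConv ((f : B →ₐ[ℂ] A).toLinearMap) *
      WithConv.toConv (HopfAlgebra.antipode ℂ ∘ₗ (f : B →ₐ[ℂ] A).toLinearMap) = 1 := by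
    ext x
    have h := HopfAlgebra.mul_antipode_lTensor_comul_apply (R := ℂ) (f x)
    rw [← CoalgHomClass.map_comp_comul_apply, ← (Coalgebra.Repr.arbitrary ℂ x).eq] at h
    rw [(Coalgebra.Repr.arbitrary ℂ x).convMul_apply]
    simpa using h
  have := left_inv_eq_right_inv h1 h2
  exact congrArg (fun g : WithConv (B →ₗ[ℂ] A) => g.ofConv x) this

end Basic

/-! ## Dual quantum subgroups: examples -/

section Dual

variable (A : Type*) [Ring A] [StarRing A] [HopfAlgebra ℂ A] [CQGAlgebra A]

/-- `G` as a dual quantum subgroup of itself. -/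
def DualQuantumSubgroup.self : DualQuantumSubgroup A A where
  incl := BialgHom.id ℂ A
  incl_star _ := rfl
  injective := Function.injective_id

/-- The trivial group as a dual quantum subgroup of `G`, i.e. the inclusion `ℂ 1 ⊆ O(G)`. -/
def DualQuantumSubgroup.trivial : DualQuantumSubgroup ℂ A where
  incl := Bialgebra.unitBialgHom ℂ A
  incl_star c := algebraMap_star_comm (R := ℂ) (A := A) c
  injective := Bialgebra.algebraMap_injective A

end Dual

/-! ## The quantum permutation group `S_N^+` -/

section SPlus

lemma adjoin_ringQuot {X : Type*} (r : FreeAlgebra ℂ X → FreeAlgebra ℂ X → Prop) :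
    Algebra.adjoin ℂ (Set.range (fun x => RingQuot.mkAlgHom ℂ r (FreeAlgebra.ι ℂ x))) = ⊤ := by
  have h := congrArg (Subalgebra.map (RingQuot.mkAlgHom ℂ r)) (FreeAlgebra.adjoin_range_ι ℂ X)
  rw [AlgHom.map_adjoin, ← Set.range_comp, Algebra.map_top,
    AlgHom.range_eq_top _ |>.2 (RingQuot.mkAlgHom_surjective ℂ r)] at h
  exact h

/-- The defining relations of `O(S_N^+)`. -/
inductive SPlusRel (N : ℕ) :
    FreeAlgebra ℂ (Fin N × Fin N) → FreeAlgebra ℂ (Fin N × Fin N) → Prop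
  | idem (i j) : SPlusRel N (FreeAlgebra.ι ℂ (i, j) * FreeAlgebra.ι ℂ (i, j))
      (FreeAlgebra.ι ℂ (i, j))
  | row_sum (i) : SPlusRel N (∑ k, FreeAlgebra.ι ℂ (i, k)) 1
  | col_sum (j) : SPlusRel N (∑ k, FreeAlgebra.ι ℂ (k, j)) 1
  | col_orth (i j k) : SPlusRel N (FreeAlgebra.ι ℂ (i, k) * FreeAlgebra.ι ℂ (j, k))
      (if i = j then FreeAlgebra.ι ℂ (i, k) else 0)
  | row_orth (i j k) : SPlusRel N (FreeAlgebra.ι ℂ (k, i) * FreeAlgebra.ι ℂ (k, j))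
      (if i = j then FreeAlgebra.ι ℂ (k, i) else 0)

/-- The CQG-algebra `O(S_N^+)` of the quantum permutation group: the universal unital `*`-algebra
generated by self-adjoint elements `p i j` subject to the relations `SPlusRel`. Its involution
(for which the generators are self-adjoint) and its Hopf algebra structure are given below. -/
def OSPlus (N : ℕ) : Type := RingQuot (SPlusRel N)

namespace OSPlus

variable {N : ℕ}

instance : Ring (OSPlus N) := inferInstanceAs (Ring (RingQuot (SPlusRel N)))
instance : Algebra ℂ (OSPlus N) := inferInstanceAs (Algebra ℂ (RingQuot (SPlusRel N)))

/-- The generators of `O(S_N^+)`. -/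
def p (i j : Fin N) : OSPlus N := RingQuot.mkAlgHom ℂ (SPlusRel N) (FreeAlgebra.ι ℂ (i, j))

/-- Families of elements of an algebra satisfying the relations of the generators of
`O(S_N^+)`. -/
structure IsMagic {B : Type*} [Ring B] (q : Fin N → Fin N → B) : Prop where
  row_sum : ∀ i, ∑ k, q i k = 1
  col_sum : ∀ j, ∑ k, q k j = 1
  col_orth : ∀ i j k, q i k * q j k = if i = j then q i k else 0
  row_orth : ∀ i j k, q k i * q k j = if i = j then q k i else 0

lemma isMagic_p : IsMagic (p (N := N)) where
  row_sum i := by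
    have := RingQuot.mkAlgHom_rel ℂ (SPlusRel.row_sum i)
    rw [map_sum, map_one] at this; exact this
  col_sum i := by
    have := RingQuot.mkAlgHom_rel ℂ (SPlusRel.col_sum i)
    rw [map_sum, map_one] at this; exact this
  col_orth i j k := by
    have := RingQuot.mkAlgHom_rel ℂ (SPlusRel.col_orth i j k)
    rw [map_mul, apply_ite (RingQuot.mkAlgHom ℂ (SPlusRel N)), map_zero] at this; exact this
  row_orth i j k := by
    have := RingQuot.mkAlgHom_rel ℂ (SPlusRel.row_orth i j k)
    rw [map_mul, apply_ite (RingQuot.mkAlgHom ℂ (SPlusRel N)), map_zero] at this; exact this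

lemma adjoin_p : Algebra.adjoin ℂ (Set.range (fun ij : Fin N × Fin N => p ij.1 ij.2)) = ⊤ :=
  adjoin_ringQuot (SPlusRel N)

section lift
variable {B : Type*} [Ring B] [Algebra ℂ B]

lemma IsMagic.map {C : Type*} [Ring C] [Algebra ℂ C] {q : Fin N → Fin N → B} (hq : IsMagic q)
    (f : B →ₐ[ℂ] C) : IsMagic (fun i j => f (q i j)) where
  row_sum i := by rw [← map_sum, hq.row_sum, map_one]
  col_sum i := by rw [← map_sum, hq.col_sum, map_one]
  col_orth i j k := by rw [← map_mul, hq.col_orth]; split_ifs <;> simp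
  row_orth i j k := by rw [← map_mul, hq.row_orth]; split_ifs <;> simp

/-- The universal property of `O(S_N^+)`. -/
def lift (q : Fin N → Fin N → B) (hq : IsMagic q) : OSPlus N →ₐ[ℂ] B :=
  RingQuot.liftAlgHom ℂ ⟨FreeAlgebra.lift ℂ (fun ij => q ij.1 ij.2), by
    intro x y h
    induction h with
    | idem i j => simpa using hq.row_orth j j i
    | row_sum i => simpa using hq.row_sum i
    | col_sum j => simpa using hq.col_sum j
    | col_orth i j k =>
      have := hq.col_orth i j k
      split_ifs at this ⊢ <;> simpa using this
    | row_orth i j k =>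
      have := hq.row_orth i j k
      split_ifs at this ⊢ <;> simpa using this⟩

@[simp] lemma lift_p (q : Fin N → Fin N → B) (hq : IsMagic q) (i j : Fin N) :
    lift q hq (p i j) = q i j := by
  unfold lift p
  erw [RingQuot.liftAlgHom_mkAlgHom_apply]
  simp

lemma hom_ext {f g : OSPlus N →ₐ[ℂ] B} (h : ∀ i j, f (p i j) = g (p i j)) : f = g :=
  AlgHom.ext_of_adjoin_eq_top adjoin_p (by rintro _ ⟨⟨i, j⟩, rfl⟩; exact h i j)

end lift

lemma IsMagic.conjOp {B : Type*} [Ring B] [Algebra ℂ B] {q : Fin N → Fin N → B}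
    (hq : IsMagic q) : IsMagic (fun i j => ConjOp.to (q i j)) where
  row_sum i := by rw [← ConjOp.to_sum, hq.row_sum, ConjOp.to_one]
  col_sum i := by rw [← ConjOp.to_sum, hq.col_sum, ConjOp.to_one]
  col_orth i j k := by
    rw [← ConjOp.to_mul, hq.col_orth]
    by_cases h : i = j
    · simp [h]
    · simp [h, Ne.symm h]
  row_orth i j k := by
    rw [← ConjOp.to_mul, hq.row_orth]
    by_cases h : i = j
    · simp [h]
    · simp [h, Ne.symm h]

/-- The transposed family in the opposite algebra. -/
lemma IsMagic.opTranspose {B : Type*} [Ring B] {q : Fin N → Fin N → B}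
    (hq : IsMagic q) : IsMagic (fun i j => MulOpposite.op (q j i)) where
  row_sum i := by rw [← Finset.op_sum, hq.col_sum, MulOpposite.op_one]
  col_sum i := by rw [← Finset.op_sum, hq.row_sum, MulOpposite.op_one]
  col_orth i j k := by
    rw [← MulOpposite.op_mul, hq.row_orth]
    by_cases h : i = j
    · simp [h]
    · simp [h, Ne.symm h]
  row_orth i j k := by
    rw [← MulOpposite.op_mul, hq.col_orth]
    by_cases h : i = j
    · simp [h]
    · simp [h, Ne.symm h]

def starHom (N : ℕ) : OSPlus N →ₐ[ℂ] ConjOp (OSPlus N) :=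
  lift (fun i j => ConjOp.to (p i j)) isMagic_p.conjOp

lemma starHom_involutive : ∀ x ∈ Set.range (fun ij : Fin N × Fin N => p ij.1 ij.2),
    (starHom N (starHom N x).of).of = x := by
  rintro _ ⟨⟨i, j⟩, rfl⟩
  simp [starHom]

instance : StarRing (OSPlus N) := starRingOfHom (starHom N) _ adjoin_p starHom_involutive
instance : StarModule ℂ (OSPlus N) := starModuleOfHom (starHom N) _ adjoin_p starHom_involutive

@[simp] lemma star_p (i j : Fin N) : star (p i j) = p i j := by
  change (starHom N (p i j)).of = _
  simp [starHom]

lemma IsMagic.comul {B : Type*} [Ring B] [Algebra ℂ B] {q : Fin N → Fin N → B}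
    (hq : IsMagic q) : IsMagic (fun i j => ∑ k, q i k ⊗ₜ[ℂ] q k j) where
  row_sum i := by
    rw [Finset.sum_comm]
    simp only [← TensorProduct.tmul_sum, hq.row_sum, ← TensorProduct.sum_tmul]
    rfl
  col_sum i := by
    rw [Finset.sum_comm]
    simp only [← TensorProduct.sum_tmul, hq.col_sum, ← TensorProduct.tmul_sum]
    rfl
  col_orth i j k := by
    simp only [Finset.sum_mul_sum, Algebra.TensorProduct.tmul_mul_tmul, hq.col_orth]
    by_cases h : i = j
    · subst h
      simp [hq.row_orth, TensorProduct.tmul_ite, TensorProduct.ite_tmul]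
    · simp [h, hq.col_orth, TensorProduct.tmul_ite]
  row_orth i j k := by
    simp only [Finset.sum_mul_sum, Algebra.TensorProduct.tmul_mul_tmul, hq.row_orth]
    by_cases h : i = j
    · subst h
      simp [hq.row_orth, TensorProduct.tmul_ite, TensorProduct.ite_tmul]
    · simp [h, hq.row_orth, TensorProduct.ite_tmul]

lemma isMagic_counit : IsMagic (fun i j : Fin N => if i = j then (1 : ℂ) else 0) where
  row_sum i := by simp
  col_sum i := by simp
  col_orth i j k := by split_ifs <;> simp_all
  row_orth i j k := by split_ifs <;> simp_all

/-- The coproduct `Δ(p i j) = ∑ k, p i k ⊗ p k j`. -/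
def comulHom (N : ℕ) : OSPlus N →ₐ[ℂ] OSPlus N ⊗[ℂ] OSPlus N :=
  lift (fun i j => ∑ k, p i k ⊗ₜ[ℂ] p k j) isMagic_p.comul

/-- The counit `ε(p i j) = δ i j`. -/
def counitHom (N : ℕ) : OSPlus N →ₐ[ℂ] ℂ :=
  lift (fun i j => if i = j then (1 : ℂ) else 0) isMagic_counit

/-- The antipode `S(p i j) = p j i`. -/
def antipodeHom (N : ℕ) : OSPlus N →ₐ[ℂ] (OSPlus N)ᵐᵒᵖ :=
  lift (fun i j => MulOpposite.op (p j i)) isMagic_p.opTranspose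

instance : Bialgebra ℂ (OSPlus N) :=
  Bialgebra.ofAlgHom (comulHom N) (counitHom N)
    (hom_ext fun i j => by
      simp only [comulHom, AlgHom.comp_apply, lift_p, map_sum, Algebra.TensorProduct.map_tmul,
        TensorProduct.sum_tmul, TensorProduct.tmul_sum, AlgHom.id_apply]
      rw [Finset.sum_comm]
      rfl)
    (hom_ext fun i j => by
      simp [comulHom, counitHom, TensorProduct.ite_tmul])
    (hom_ext fun i j => by
      simp [comulHom, counitHom, TensorProduct.tmul_ite])

lemma comul_p (i j : Fin N) :
    Coalgebra.comul (R := ℂ) (p i j) = ∑ k, p i k ⊗ₜ[ℂ] p k j :=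
  lift_p _ isMagic_p.comul i j

lemma counit_p (i j : Fin N) :
    Coalgebra.counit (R := ℂ) (p i j) = if i = j then 1 else 0 :=
  lift_p _ isMagic_counit i j

instance : HopfAlgebra ℂ (OSPlus N) :=
  hopfOfAntiHom (antipodeHom N) _ adjoin_p
    (by
      rintro _ ⟨⟨i, j⟩, rfl⟩
      simp only [comul_p, counit_p, antipodeHom, map_sum, LinearMap.rTensor_tmul,
        LinearMap.comp_apply, AlgHom.toLinearMap_apply, lift_p, LinearMap.mul'_apply]
      simp only [LinearEquiv.coe_coe, MulOpposite.coe_opLinearEquiv_symm, MulOpposite.unop_op,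
        isMagic_p.row_orth, isMagic_p.col_orth]
      by_cases h : i = j
      · simp [h, isMagic_p.row_sum, isMagic_p.col_sum]
      · simp [h])
    (by
      rintro _ ⟨⟨i, j⟩, rfl⟩
      simp only [comul_p, counit_p, antipodeHom, map_sum, LinearMap.lTensor_tmul,
        LinearMap.comp_apply, AlgHom.toLinearMap_apply, lift_p, LinearMap.mul'_apply]
      simp only [LinearEquiv.coe_coe, MulOpposite.coe_opLinearEquiv_symm, MulOpposite.unop_op,
        isMagic_p.row_orth, isMagic_p.col_orth]
      by_cases h : i = j
      · simp [h, isMagic_p.row_sum, isMagic_p.col_sum]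
      · simp [h])

lemma antipode_p (i j : Fin N) : HopfAlgebra.antipode ℂ (p i j) = p j i :=
  congrArg MulOpposite.unop (lift_p _ isMagic_p.opTranspose i j)

instance : HopfStarAlgebra (OSPlus N) :=
  hopfStarOfAdjoin _ adjoin_p (by
    rintro _ ⟨⟨i, j⟩, rfl⟩
    simp [comul_p])

lemma isUnitaryCorep_p : IsUnitaryCorep (p : Matrix (Fin N) (Fin N) (OSPlus N)) where
  unitary := (isUnitaryCorep_iff_sums _).2
    ⟨fun i j => by
      by_cases h : i = j
      · simp [isMagic_p.row_orth, h, isMagic_p.col_sum]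
      · simp [isMagic_p.row_orth, h],
    fun i j => by
      by_cases h : i = j
      · simp [isMagic_p.col_orth, h, isMagic_p.row_sum]
      · simp [isMagic_p.col_orth, h]⟩
  comul := comul_p

instance : CQGAlgebra (OSPlus N) :=
  cqgOfAdjoin _ adjoin_p (by
    rintro _ ⟨⟨i, j⟩, rfl⟩
    exact Submodule.subset_span (isUnitaryCorep_p.mem_matrixCoefficients i j))

end OSPlus

end SPlus

/-! ## Free wreath products -/

section Wreath

/-- A subset of a Hopf `*`-algebra stable under the involution, the antipode and the coproduct.
The only instances of interest are the empty set (no amalgamation) and the image of a dual quantum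
subgroup. -/
structure HopfStarSubset (A : Type*) [Ring A] [StarRing A] [HopfAlgebra ℂ A] where
  carrier : Set A
  star_mem : ∀ x ∈ carrier, star x ∈ carrier
  antipode_mem : ∀ x ∈ carrier, HopfAlgebra.antipode ℂ x ∈ carrier
  comul_mem : ∀ x ∈ carrier, Coalgebra.comul (R := ℂ) x ∈
    Submodule.span ℂ {t | ∃ a ∈ carrier, ∃ b ∈ carrier, a ⊗ₜ[ℂ] b = t}

/-- The empty subset. -/
def HopfStarSubset.empty (A : Type*) [Ring A] [StarRing A] [HopfAlgebra ℂ A] :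
    HopfStarSubset A where
  carrier := ∅
  star_mem _ h := h.elim
  antipode_mem _ h := h.elim
  comul_mem _ h := h.elim

/-- The image of `O(H)` in `O(G)`, for a dual quantum subgroup `H` of `G`. -/
def DualQuantumSubgroup.image {A B : Type*} [Ring A] [StarRing A] [HopfAlgebra ℂ A] [CQGAlgebra A]
    [Ring B] [StarRing B] [HopfAlgebra ℂ B] [CQGAlgebra B] (H : DualQuantumSubgroup B A) :
    HopfStarSubset A where
  carrier := Set.range H.incl
  star_mem := by rintro _ ⟨y, rfl⟩; exact ⟨star y, H.incl_star y⟩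
  antipode_mem := by rintro _ ⟨y, rfl⟩; exact ⟨_, map_antipode H.incl y⟩
  comul_mem := by
    rintro _ ⟨y, rfl⟩
    rw [← CoalgHomClass.map_comp_comul_apply]
    generalize Coalgebra.comul (R := ℂ) y = t
    induction t with
    | zero => simp
    | add x y hx hy => rw [map_add]; exact add_mem hx hy
    | tmul x y => exact Submodule.subset_span ⟨_, ⟨x, rfl⟩, _, ⟨y, rfl⟩, rfl⟩

variable {A : Type*} [Ring A] [StarRing A] [HopfAlgebra ℂ A]

/-- The defining relations of the free wreath product, on formal symbols `ν i x` for `i : Fin N`,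
`x : A` (written `Sum.inl (i, x)`) and `σ y` for `y : O(S_N^+)` (written `Sum.inr y`):
each `ν i` and `σ` are homomorphisms of unital algebras (so that one gets the free product of `N`
copies of `A` and `O(S_N^+)`), the copies of the elements of `K` are identified with each other
(amalgamation), and `ν i x` commutes with `σ (p i j)`. -/
inductive WreathRel (K : HopfStarSubset A) (N : ℕ) :
    FreeAlgebra ℂ (Fin N × A ⊕ OSPlus N) → FreeAlgebra ℂ (Fin N × A ⊕ OSPlus N) → Prop
  | nu_one (i) : WreathRel K N (FreeAlgebra.ι ℂ (Sum.inl (i, 1))) 1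
  | nu_add (i x y) : WreathRel K N (FreeAlgebra.ι ℂ (Sum.inl (i, x + y)))
      (FreeAlgebra.ι ℂ (Sum.inl (i, x)) + FreeAlgebra.ι ℂ (Sum.inl (i, y)))
  | nu_smul (i) (c : ℂ) (x) : WreathRel K N (FreeAlgebra.ι ℂ (Sum.inl (i, c • x)))
      (c • FreeAlgebra.ι ℂ (Sum.inl (i, x)))
  | nu_mul (i x y) : WreathRel K N (FreeAlgebra.ι ℂ (Sum.inl (i, x * y)))
      (FreeAlgebra.ι ℂ (Sum.inl (i, x)) * FreeAlgebra.ι ℂ (Sum.inl (i, y)))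
  | sigma_one : WreathRel K N (FreeAlgebra.ι ℂ (Sum.inr 1)) 1
  | sigma_add (x y) : WreathRel K N (FreeAlgebra.ι ℂ (Sum.inr (x + y)))
      (FreeAlgebra.ι ℂ (Sum.inr x) + FreeAlgebra.ι ℂ (Sum.inr y))
  | sigma_smul (c : ℂ) (x) : WreathRel K N (FreeAlgebra.ι ℂ (Sum.inr (c • x)))
      (c • FreeAlgebra.ι ℂ (Sum.inr x))
  | sigma_mul (x y) : WreathRel K N (FreeAlgebra.ι ℂ (Sum.inr (x * y)))
      (FreeAlgebra.ι ℂ (Sum.inr x) * FreeAlgebra.ι ℂ (Sum.inr y))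
  | amalg (i j x) : x ∈ K.carrier → WreathRel K N (FreeAlgebra.ι ℂ (Sum.inl (i, x)))
      (FreeAlgebra.ι ℂ (Sum.inl (j, x)))
  | comm (i j x) : WreathRel K N
      (FreeAlgebra.ι ℂ (Sum.inl (i, x)) * FreeAlgebra.ι ℂ (Sum.inr (OSPlus.p i j)))
      (FreeAlgebra.ι ℂ (Sum.inr (OSPlus.p i j)) * FreeAlgebra.ι ℂ (Sum.inl (i, x)))

/-- The quotient of the free product of `N` copies of `A`, amalgamated over `K`, and of
`O(S_N^+)` by the relations `[ν i x, p i j] = 0`. -/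
def OWreath (K : HopfStarSubset A) (N : ℕ) : Type _ := RingQuot (WreathRel K N)

namespace OWreath

variable {K : HopfStarSubset A} {N : ℕ}

instance : Ring (OWreath K N) := inferInstanceAs (Ring (RingQuot (WreathRel K N)))
instance : Algebra ℂ (OWreath K N) := inferInstanceAs (Algebra ℂ (RingQuot (WreathRel K N)))

/-- The canonical homomorphism from `A` to the `i`-th factor. -/
def nu (K : HopfStarSubset A) (i : Fin N) : A →ₐ[ℂ] OWreath K N :=
  AlgHom.ofLinearMap
    { toFun := fun x => RingQuot.mkAlgHom ℂ (WreathRel K N) (FreeAlgebra.ι ℂ (Sum.inl (i, x)))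
      map_add' := fun x y => by
        have := RingQuot.mkAlgHom_rel ℂ (WreathRel.nu_add (K := K) i x y)
        rw [map_add] at this; exact this
      map_smul' := fun c x => by
        have := RingQuot.mkAlgHom_rel ℂ (WreathRel.nu_smul (K := K) i c x)
        rw [map_smul] at this; exact this }
    (by
      have := RingQuot.mkAlgHom_rel ℂ (WreathRel.nu_one (K := K) i)
      rw [map_one] at this; exact this)
    (fun x y => by
      have := RingQuot.mkAlgHom_rel ℂ (WreathRel.nu_mul (K := K) i x y)
      rw [map_mul] at this; exact this)

/-- The canonical homomorphism from `O(S_N^+)`. -/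
def sigma (K : HopfStarSubset A) (N : ℕ) : OSPlus N →ₐ[ℂ] OWreath K N :=
  AlgHom.ofLinearMap
    { toFun := fun x => RingQuot.mkAlgHom ℂ (WreathRel K N) (FreeAlgebra.ι ℂ (Sum.inr x))
      map_add' := fun x y => by
        have := RingQuot.mkAlgHom_rel ℂ (WreathRel.sigma_add (K := K) x y)
        rw [map_add] at this; exact this
      map_smul' := fun c x => by
        have := RingQuot.mkAlgHom_rel ℂ (WreathRel.sigma_smul (K := K) c x)
        rw [map_smul] at this; exact this }
    (by
      have := RingQuot.mkAlgHom_rel ℂ (WreathRel.sigma_one (K := K) (N := N))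
      rw [map_one] at this; exact this)
    (fun x y => by
      have := RingQuot.mkAlgHom_rel ℂ (WreathRel.sigma_mul (K := K) x y)
      rw [map_mul] at this; exact this)

/-- The generators `p i j` in the free wreath product. -/
def P (K : HopfStarSubset A) (i j : Fin N) : OWreath K N := sigma K N (OSPlus.p i j)

lemma isMagic_P : OSPlus.IsMagic (P K (N := N)) := OSPlus.isMagic_p.map (sigma K N)

lemma nu_comm (i j : Fin N) (x : A) : nu K i x * P K i j = P K i j * nu K i x := by
  have := RingQuot.mkAlgHom_rel ℂ (WreathRel.comm (K := K) i j x)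
  rw [map_mul, map_mul] at this; exact this

lemma nu_amalg (i j : Fin N) {x : A} (hx : x ∈ K.carrier) : nu K i x = nu K j x :=
  RingQuot.mkAlgHom_rel ℂ (WreathRel.amalg (K := K) i j x hx)

/-- The generators of the free wreath product. -/
def generators (K : HopfStarSubset A) (N : ℕ) : Set (OWreath K N) :=
  Set.range (fun ix : Fin N × A => nu K ix.1 ix.2) ∪
    Set.range (fun ij : Fin N × Fin N => P K ij.1 ij.2)

lemma adjoin_symbols : Algebra.adjoin ℂ (Set.range (fun s : Fin N × A ⊕ OSPlus N =>
    (RingQuot.mkAlgHom ℂ (WreathRel K N) (FreeAlgebra.ι ℂ s) : OWreath K N))) = ⊤ :=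
  adjoin_ringQuot (WreathRel K N)

lemma adjoin_generators : Algebra.adjoin ℂ (generators K N) = ⊤ := by
  rw [eq_top_iff]
  refine le_trans adjoin_symbols.ge (Algebra.adjoin_le ?_)
  rintro _ ⟨⟨i, x⟩ | y, rfl⟩
  · change nu K i x ∈ _
    exact Algebra.subset_adjoin (Or.inl ⟨(i, x), rfl⟩)
  · have h : (sigma K N).range ≤ Algebra.adjoin ℂ (generators K N) := by
      rw [← Algebra.map_top, ← OSPlus.adjoin_p, AlgHom.map_adjoin]
      refine Algebra.adjoin_mono ?_
      rintro _ ⟨_, ⟨ij, rfl⟩, rfl⟩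
      exact Or.inr ⟨ij, rfl⟩
    exact h ⟨y, rfl⟩

section lift
variable {B : Type*} [Ring B] [Algebra ℂ B]

lemma hom_ext {f g : OWreath K N →ₐ[ℂ] B} (hn : ∀ i x, f (nu K i x) = g (nu K i x))
    (hp : ∀ i j, f (P K i j) = g (P K i j)) : f = g :=
  AlgHom.ext_of_adjoin_eq_top adjoin_generators (by
    rintro _ (⟨⟨i, x⟩, rfl⟩ | ⟨⟨i, j⟩, rfl⟩)
    · exact hn i x
    · exact hp i j)

/-- The universal property of `OWreath K N`. -/
def lift (f : Fin N → A →ₐ[ℂ] B) (g : OSPlus N →ₐ[ℂ] B)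
    (ha : ∀ i j, ∀ x ∈ K.carrier, f i x = f j x)
    (hc : ∀ i j x, f i x * g (OSPlus.p i j) = g (OSPlus.p i j) * f i x) :
    OWreath K N →ₐ[ℂ] B :=
  RingQuot.liftAlgHom ℂ ⟨FreeAlgebra.lift ℂ (Sum.elim (fun ix => f ix.1 ix.2) g), by
    intro x y h
    induction h with
    | amalg i j x hx => simpa using ha i j x hx
    | comm i j x => simpa using hc i j x
    | _ => simp⟩

variable (f : Fin N → A →ₐ[ℂ] B) (g : OSPlus N →ₐ[ℂ] B)
    (ha : ∀ i j, ∀ x ∈ K.carrier, f i x = f j x)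
    (hc : ∀ i j x, f i x * g (OSPlus.p i j) = g (OSPlus.p i j) * f i x)

@[simp] lemma lift_nu (i : Fin N) (x : A) : lift f g ha hc (nu K i x) = f i x := by
  change lift f g ha hc (RingQuot.mkAlgHom ℂ (WreathRel K N) (FreeAlgebra.ι ℂ (Sum.inl (i, x)))) = _
  unfold lift
  erw [RingQuot.liftAlgHom_mkAlgHom_apply]
  simp

@[simp] lemma lift_sigma (y : OSPlus N) : lift f g ha hc (sigma K N y) = g y := by
  change lift f g ha hc (RingQuot.mkAlgHom ℂ (WreathRel K N) (FreeAlgebra.ι ℂ (Sum.inr y))) = _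
  unfold lift
  erw [RingQuot.liftAlgHom_mkAlgHom_apply]
  simp

@[simp] lemma lift_P (i j : Fin N) : lift f g ha hc (P K i j) = g (OSPlus.p i j) :=
  lift_sigma f g ha hc _

end lift

/-! ### The involution -/

/-- A homomorphism, seen between the conjugate opposite algebras. -/
def conjOpMap {B C : Type*} [Ring B] [Algebra ℂ B] [Ring C] [Algebra ℂ C] (f : B →ₐ[ℂ] C) :
    ConjOp B →ₐ[ℂ] ConjOp C where
  toFun x := ConjOp.to (f x.of)
  map_one' := by simp
  map_mul' x y := by simp
  map_zero' := by simp
  map_add' x y := by simp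
  commutes' c := by simp

lemma conjOpMap_apply {B C : Type*} [Ring B] [Algebra ℂ B] [Ring C] [Algebra ℂ C] (f : B →ₐ[ℂ] C)
    (x : B) : conjOpMap f (ConjOp.to x) = ConjOp.to (f x) := rfl

lemma starToConjOp_apply {B : Type*} [Ring B] [Algebra ℂ B] [StarRing B] [StarModule ℂ B]
    (x : B) : starToConjOp B x = ConjOp.to (star x) := rfl

section Star
variable [HopfStarAlgebra A]

lemma starHom_amalg (i j : Fin N) (x : A) (hx : x ∈ K.carrier) :
    ((conjOpMap (nu K i)).comp (starToConjOp A)) x =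
      ((conjOpMap (nu K j)).comp (starToConjOp A)) x :=
  congrArg ConjOp.to (nu_amalg i j (K.star_mem x hx))

lemma starHom_comm (i j : Fin N) (x : A) :
    ((conjOpMap (nu K i)).comp (starToConjOp A)) x *
      ((conjOpMap (sigma K N)).comp (starToConjOp (OSPlus N))) (OSPlus.p i j) =
    ((conjOpMap (sigma K N)).comp (starToConjOp (OSPlus N))) (OSPlus.p i j) *
      ((conjOpMap (nu K i)).comp (starToConjOp A)) x := by
  simp only [AlgHom.comp_apply, starToConjOp_apply, conjOpMap_apply, OSPlus.star_p]
  exact congrArg ConjOp.to (nu_comm i j (star x)).symm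

def starHom (K : HopfStarSubset A) (N : ℕ) : OWreath K N →ₐ[ℂ] ConjOp (OWreath K N) :=
  lift (fun i => (conjOpMap (nu K i)).comp (starToConjOp A))
    ((conjOpMap (sigma K N)).comp (starToConjOp (OSPlus N))) starHom_amalg starHom_comm

lemma starHom_nu (i : Fin N) (x : A) :
    starHom K N (nu K i x) = ConjOp.to (nu K i (star x)) := by
  unfold starHom; rw [lift_nu]; rfl

lemma starHom_P (i j : Fin N) : starHom K N (P K i j) = ConjOp.to (P K i j) := by
  unfold starHom
  rw [lift_P, AlgHom.comp_apply, starToConjOp_apply, OSPlus.star_p]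
  rfl

lemma starHom_involutive : ∀ x ∈ generators K N, (starHom K N (starHom K N x).of).of = x := by
  rintro _ (⟨⟨i, x⟩, rfl⟩ | ⟨⟨i, j⟩, rfl⟩)
  · simp [starHom_nu]
  · simp [starHom_P]

instance : StarRing (OWreath K N) :=
  starRingOfHom (starHom K N) _ adjoin_generators starHom_involutive
instance : StarModule ℂ (OWreath K N) :=
  starModuleOfHom (starHom K N) _ adjoin_generators starHom_involutive

lemma star_nu (i : Fin N) (x : A) : star (nu K i x) = nu K i (star x) :=
  congrArg ConjOp.of (starHom_nu i x)

lemma star_P (i j : Fin N) : star (P K i j) = P K i j :=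
  congrArg ConjOp.of (starHom_P i j)

end Star

/-! ### The Hopf algebra structure -/

/-- Given a partition of unity `e k` and homomorphisms `f k` commuting with `e k`, the map
`x ↦ ∑ k, e k * f k x` is a homomorphism. -/
def sumHom {B C : Type*} [Ring B] [Algebra ℂ B] [Ring C] [Algebra ℂ C] (e : Fin N → C)
    (f : Fin N → B →ₐ[ℂ] C) (h1 : ∑ k, e k = 1) (h2 : ∀ k l, e k * e l = if k = l then e k else 0)
    (h3 : ∀ k x, e k * f k x = f k x * e k) : B →ₐ[ℂ] C :=
  AlgHom.ofLinearMap (∑ k, LinearMap.mulLeft ℂ (e k) ∘ₗ (f k).toLinearMap)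
    (by simp [LinearMap.sum_apply, h1])
    (fun x y => by
      simp only [LinearMap.sum_apply, LinearMap.comp_apply, LinearMap.mulLeft_apply,
        AlgHom.toLinearMap_apply, Finset.sum_mul_sum, map_mul]
      refine Finset.sum_congr rfl fun k _ => ?_
      have : ∀ l, e k * f k x * (e l * f l y) = if k = l then e k * (f k x * f k y) else 0 := by
        intro l
        rw [h3 k x, mul_assoc, ← mul_assoc (e k), h2]
        split_ifs with h
        · subst h
          rw [← mul_assoc, ← h3, mul_assoc]
        · simp
      simp [this])

lemma sumHom_apply {B C : Type*} [Ring B] [Algebra ℂ B] [Ring C] [Algebra ℂ C] (e : Fin N → C)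
    (f : Fin N → B →ₐ[ℂ] C) (h1 : ∑ k, e k = 1) (h2 : ∀ k l, e k * e l = if k = l then e k else 0)
    (h3 : ∀ k x, e k * f k x = f k x * e k) (x : B) :
    sumHom e f h1 h2 h3 x = ∑ k, e k * f k x := by
  change (∑ k, LinearMap.mulLeft ℂ (e k) ∘ₗ (f k).toLinearMap) x = _
  simp [LinearMap.sum_apply]

/-- The homomorphism `x ↦ ∑ k, p i k ⊗ ν k x`. -/
def rightHom (K : HopfStarSubset A) (i : Fin N) : A →ₐ[ℂ] OWreath K N ⊗[ℂ] OWreath K N :=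
  sumHom (fun k => P K i k ⊗ₜ[ℂ] (1 : OWreath K N))
    (fun k => (Algebra.TensorProduct.includeRight : OWreath K N →ₐ[ℂ] _).comp (nu K k))
    (by rw [← TensorProduct.sum_tmul, isMagic_P.row_sum]; rfl)
    (fun k l => by
      rw [Algebra.TensorProduct.tmul_mul_tmul, isMagic_P.row_orth]
      split_ifs <;> simp)
    (fun k x => by simp)

lemma rightHom_apply (i : Fin N) (x : A) :
    rightHom K i x = ∑ k, P K i k ⊗ₜ[ℂ] nu K k x := by
  simp [rightHom, sumHom_apply]

/-- The homomorphism `x ⊗ y ↦ ∑ k, (ν i x ⊗ ν k y) (p i k ⊗ 1)`. -/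
def deltaHom (K : HopfStarSubset A) (i : Fin N) :
    A ⊗[ℂ] A →ₐ[ℂ] OWreath K N ⊗[ℂ] OWreath K N :=
  Algebra.TensorProduct.lift
    ((Algebra.TensorProduct.includeLeft : OWreath K N →ₐ[ℂ] _).comp (nu K i)) (rightHom K i)
    (fun x y => by
      change _ * _ = _ * _
      simp [rightHom_apply, Finset.mul_sum, Finset.sum_mul, nu_comm])

lemma deltaHom_tmul (i : Fin N) (x y : A) :
    deltaHom K i (x ⊗ₜ y) = ∑ k, (nu K i x * P K i k) ⊗ₜ[ℂ] nu K k y := by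
  simp [deltaHom, rightHom_apply, Finset.mul_sum]

/-- The coproduct is given by `Δ(ν i x) = ∑ k, (ν i ⊗ ν k)(Δ x) (p i k ⊗ 1)` and
`Δ(p i j) = ∑ k, p i k ⊗ p k j`. -/
def comulHom (K : HopfStarSubset A) (N : ℕ) :
    OWreath K N →ₐ[ℂ] OWreath K N ⊗[ℂ] OWreath K N :=
  lift (fun i => (deltaHom K i).comp (Bialgebra.comulAlgHom ℂ A))
    ((Algebra.TensorProduct.map (sigma K N) (sigma K N)).comp
      (Bialgebra.comulAlgHom ℂ (OSPlus N)))
    (fun i j x hx => by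
      simp only [AlgHom.comp_apply, Bialgebra.comulAlgHom_apply]
      have h := K.comul_mem x hx
      generalize Coalgebra.comul (R := ℂ) x = t at h
      induction h using Submodule.span_induction with
      | mem t ht =>
        obtain ⟨a, ha, b, hb, rfl⟩ := ht
        have key : ∀ i : Fin N, deltaHom K i (a ⊗ₜ[ℂ] b) = nu K i a ⊗ₜ[ℂ] nu K i b := by
          intro i
          have : ∀ k, nu K k b = nu K i b := fun k => nu_amalg k i hb
          simp only [deltaHom_tmul, this]
          rw [← TensorProduct.sum_tmul, ← Finset.mul_sum, isMagic_P.row_sum, mul_one]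
        rw [key, key, nu_amalg i j ha, nu_amalg i j hb]
      | zero => simp
      | add s t _ _ hs ht => rw [map_add, map_add, hs, ht]
      | smul c t _ ht => rw [map_smul, map_smul, ht])
    (fun i j x => by
      simp only [AlgHom.comp_apply, Bialgebra.comulAlgHom_apply, OSPlus.comul_p, map_sum,
        Algebra.TensorProduct.map_tmul]
      change _ * ∑ k, P K i k ⊗ₜ[ℂ] P K k j = (∑ k, P K i k ⊗ₜ[ℂ] P K k j) * _
      generalize Coalgebra.comul (R := ℂ) x = t
      induction t with
      | zero => simp
      | add s t hs ht => rw [map_add, add_mul, mul_add, hs, ht]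
      | tmul a b =>
        simp only [deltaHom_tmul, Finset.sum_mul_sum, Algebra.TensorProduct.tmul_mul_tmul]
        have h1 : ∀ k l, nu K i a * P K i k * P K i l = if k = l then nu K i a * P K i k else 0 := by
          intro k l
          rw [mul_assoc, isMagic_P.row_orth]
          split_ifs <;> simp
        have h2 : ∀ k l, P K i k * (nu K i a * P K i l) = if k = l then nu K i a * P K i k else 0 := by
          intro k l
          rw [← mul_assoc, ← nu_comm, h1]
        simp [h1, h2, TensorProduct.ite_tmul, ← nu_comm])

lemma comulHom_nu (i : Fin N) (x : A) :
    comulHom K N (nu K i x) = deltaHom K i (Coalgebra.comul (R := ℂ) x) := by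
  simp [comulHom]

lemma comulHom_P (i j : Fin N) :
    comulHom K N (P K i j) = ∑ k, P K i k ⊗ₜ[ℂ] P K k j := by
  simp [comulHom, OSPlus.comul_p]
  rfl

/-- The counit `ε(ν i x) = ε(x)`, `ε(p i j) = δ i j`. -/
def counitHom (K : HopfStarSubset A) (N : ℕ) : OWreath K N →ₐ[ℂ] ℂ :=
  lift (fun _ => Bialgebra.counitAlgHom ℂ A) (Bialgebra.counitAlgHom ℂ (OSPlus N))
    (fun _ _ _ _ => rfl) (fun _ _ _ => mul_comm _ _)

lemma counitHom_nu (i : Fin N) (x : A) :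
    counitHom K N (nu K i x) = Coalgebra.counit (R := ℂ) x := by
  simp [counitHom]

lemma counitHom_P (i j : Fin N) :
    counitHom K N (P K i j) = if i = j then 1 else 0 := by
  simp [counitHom, OSPlus.counit_p]

lemma comulHom_coassoc_nu (i : Fin N) (x : A) :
    (Algebra.TensorProduct.assoc ℂ ℂ ℂ (OWreath K N) (OWreath K N) (OWreath K N))
      (Algebra.TensorProduct.map (comulHom K N) (.id ℂ (OWreath K N))
        (deltaHom K i (Coalgebra.comul (R := ℂ) x))) =
    Algebra.TensorProduct.map (.id ℂ (OWreath K N)) (comulHom K N)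
      (deltaHom K i (Coalgebra.comul (R := ℂ) x)) := by
  let M : A ⊗[ℂ] (A ⊗[ℂ] A) →ₗ[ℂ] OWreath K N ⊗[ℂ] (OWreath K N ⊗[ℂ] OWreath K N) :=
    ∑ l, TensorProduct.map (LinearMap.mulRight ℂ (P K i l) ∘ₗ (nu K i).toLinearMap)
      (deltaHom K l).toLinearMap
  have hM : ∀ a t, M (a ⊗ₜ t) = ∑ l, (nu K i a * P K i l) ⊗ₜ[ℂ] deltaHom K l t := by
    intro a t
    simp [M, LinearMap.sum_apply]
  have hR : ∀ t : A ⊗[ℂ] A, Algebra.TensorProduct.map (.id ℂ (OWreath K N)) (comulHom K N)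
      (deltaHom K i t) = M ((Coalgebra.comul (R := ℂ)).lTensor A t) := by
    intro t
    induction t with
    | zero => simp
    | add s t hs ht => simp only [map_add, hs, ht]
    | tmul a b => simp [hM, deltaHom_tmul, comulHom_nu]
  have hL : ∀ t : A ⊗[ℂ] A,
      (Algebra.TensorProduct.assoc ℂ ℂ ℂ (OWreath K N) (OWreath K N) (OWreath K N))
      (Algebra.TensorProduct.map (comulHom K N) (.id ℂ (OWreath K N)) (deltaHom K i t)) =
      M (TensorProduct.assoc ℂ A A A ((Coalgebra.comul (R := ℂ)).rTensor A t)) := by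
    intro t
    induction t with
    | zero => simp
    | add s t hs ht => simp only [map_add, hs, ht]
    | tmul a b =>
      simp only [deltaHom_tmul, map_sum, Algebra.TensorProduct.map_tmul, map_mul, comulHom_nu,
        comulHom_P, LinearMap.rTensor_tmul, AlgHom.id_apply]
      generalize Coalgebra.comul (R := ℂ) a = s
      induction s with
      | zero => simp
      | add s t hs ht =>
        simp only [map_add, TensorProduct.add_tmul, add_mul, Finset.sum_add_distrib, hs, ht]
      | tmul a c =>
        simp only [deltaHom_tmul, Finset.sum_mul_sum, Algebra.TensorProduct.tmul_mul_tmul,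
          TensorProduct.assoc_tmul, hM, mul_assoc, isMagic_P.row_orth, TensorProduct.sum_tmul,
          TensorProduct.tmul_sum, map_sum, Algebra.TensorProduct.assoc_tmul, mul_ite, mul_zero,
          TensorProduct.ite_tmul, TensorProduct.zero_tmul, Finset.sum_ite_eq, Finset.mem_univ,
          if_true]
        rw [Finset.sum_comm]
  rw [hL, hR]
  exact congrArg M (Coalgebra.coassoc_apply x)

instance : Bialgebra ℂ (OWreath K N) :=
  Bialgebra.ofAlgHom (comulHom K N) (counitHom K N)
    (hom_ext
      (fun i x => by
        simp only [AlgHom.comp_apply, comulHom_nu]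
        exact comulHom_coassoc_nu i x)
      (fun i j => by
        simp only [AlgHom.comp_apply, comulHom_P, map_sum, Algebra.TensorProduct.map_tmul,
          TensorProduct.sum_tmul, TensorProduct.tmul_sum, AlgHom.id_apply]
        rw [Finset.sum_comm]
        rfl))
    (hom_ext
      (fun i x => by
        simp only [AlgHom.comp_apply, comulHom_nu]
        have key : ∀ t : A ⊗[ℂ] A,
            Algebra.TensorProduct.map (counitHom K N) (.id ℂ (OWreath K N)) (deltaHom K i t) =
            TensorProduct.map .id (nu K i).toLinearMap
              ((Coalgebra.counit (R := ℂ)).rTensor A t) := by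
          intro t
          induction t with
          | zero => simp
          | add s t hs ht => simp only [map_add, hs, ht]
          | tmul a b =>
            simp [deltaHom_tmul, counitHom_nu, counitHom_P, TensorProduct.ite_tmul]
        rw [key, Coalgebra.rTensor_counit_comul]
        simp)
      (fun i j => by
        simp [comulHom_P, counitHom_P, TensorProduct.ite_tmul]))
    (hom_ext
      (fun i x => by
        simp only [AlgHom.comp_apply, comulHom_nu]
        have key : ∀ t : A ⊗[ℂ] A,
            Algebra.TensorProduct.map (.id ℂ (OWreath K N)) (counitHom K N) (deltaHom K i t) =
            TensorProduct.map (nu K i).toLinearMap .id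
              ((Coalgebra.counit (R := ℂ)).lTensor A t) := by
          intro t
          induction t with
          | zero => simp
          | add s t hs ht => simp only [map_add, hs, ht]
          | tmul a b =>
            simp only [deltaHom_tmul, map_sum, Algebra.TensorProduct.map_tmul, counitHom_nu,
              AlgHom.id_apply, ← TensorProduct.sum_tmul, ← Finset.mul_sum, isMagic_P.row_sum]
            simp
        rw [key, Coalgebra.lTensor_counit_comul]
        simp)
      (fun i j => by
        simp [comulHom_P, counitHom_P, TensorProduct.tmul_ite]))

lemma comul_nu (i : Fin N) (x : A) :
    Coalgebra.comul (R := ℂ) (nu K i x) = deltaHom K i (Coalgebra.comul (R := ℂ) x) :=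
  comulHom_nu i x

lemma comul_P (i j : Fin N) :
    Coalgebra.comul (R := ℂ) (P K i j) = ∑ k, P K i k ⊗ₜ[ℂ] P K k j :=
  comulHom_P i j

lemma counit_nu (i : Fin N) (x : A) :
    Coalgebra.counit (R := ℂ) (nu K i x) = Coalgebra.counit (R := ℂ) x :=
  counitHom_nu i x

lemma counit_P (i j : Fin N) :
    Coalgebra.counit (R := ℂ) (P K i j) = if i = j then 1 else 0 :=
  counitHom_P i j

/-- The antihomomorphism `x ↦ ν k (S x)`. -/
def nuAntipode (K : HopfStarSubset A) (k : Fin N) : A →ₐ[ℂ] (OWreath K N)ᵐᵒᵖ :=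
  AlgHom.ofLinearMap ((MulOpposite.opLinearEquiv ℂ).toLinearMap ∘ₗ (nu K k).toLinearMap ∘ₗ
      HopfAlgebra.antipode ℂ)
    (by simp)
    (fun x y => by simp [HopfAlgebra.antipode_mul_antidistrib])

lemma nuAntipode_apply (k : Fin N) (x : A) :
    nuAntipode K k x = MulOpposite.op (nu K k (HopfAlgebra.antipode ℂ x)) := rfl

/-- The antihomomorphism `x ↦ ∑ k, ν k (S x) p k i`. -/
def antipodeNu (K : HopfStarSubset A) (i : Fin N) : A →ₐ[ℂ] (OWreath K N)ᵐᵒᵖ :=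
  sumHom (fun k => MulOpposite.op (P K k i)) (nuAntipode K)
    (isMagic_P.opTranspose.row_sum i) (fun k l => isMagic_P.opTranspose.row_orth k l i)
    (fun k x => by
      rw [nuAntipode_apply, ← MulOpposite.op_mul, ← MulOpposite.op_mul, nu_comm])

lemma antipodeNu_apply (i : Fin N) (x : A) : antipodeNu K i x =
    MulOpposite.op (∑ k, nu K k (HopfAlgebra.antipode ℂ x) * P K k i) := by
  simp [antipodeNu, sumHom_apply, nuAntipode_apply, Finset.op_sum]

/-- The antipode `S(ν i x) = ∑ k, ν k (S x) p k i`, `S(p i j) = p j i`. -/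
def antipodeHom (K : HopfStarSubset A) (N : ℕ) : OWreath K N →ₐ[ℂ] (OWreath K N)ᵐᵒᵖ :=
  lift (antipodeNu K) (OSPlus.lift _ isMagic_P.opTranspose)
    (fun i j x hx => by
      have key : ∀ i j : Fin N, antipodeNu K i x =
          MulOpposite.op (nu K j (HopfAlgebra.antipode ℂ x)) := by
        intro i j
        have : ∀ k, nu K k (HopfAlgebra.antipode ℂ x) = nu K j (HopfAlgebra.antipode ℂ x) :=
          fun k => nu_amalg k j (K.antipode_mem x hx)
        simp only [antipodeNu_apply, this, ← Finset.mul_sum, isMagic_P.col_sum, mul_one]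
      rw [key i i, key j i])
    (fun i j x => by
      rw [OSPlus.lift_p, antipodeNu_apply, ← MulOpposite.op_mul, ← MulOpposite.op_mul]
      congr 1
      rw [Finset.mul_sum, Finset.sum_mul]
      simp only [mul_assoc, isMagic_P.col_orth]
      simp only [nu_comm, ← mul_assoc, isMagic_P.col_orth]
      simp [nu_comm])

lemma antipodeHom_nu (i : Fin N) (x : A) : antipodeHom K N (nu K i x) =
    MulOpposite.op (∑ k, nu K k (HopfAlgebra.antipode ℂ x) * P K k i) := by
  simp [antipodeHom, antipodeNu_apply]

lemma antipodeHom_P (i j : Fin N) : antipodeHom K N (P K i j) = MulOpposite.op (P K j i) := by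
  simp [antipodeHom]

lemma antipode_left_nu (i : Fin N) (t : A ⊗[ℂ] A) :
    LinearMap.mul' ℂ (OWreath K N) (((MulOpposite.opLinearEquiv ℂ).symm.toLinearMap ∘ₗ
      (antipodeHom K N).toLinearMap).rTensor (OWreath K N) (deltaHom K i t)) =
    ∑ k, P K k i * nu K k (LinearMap.mul' ℂ A ((HopfAlgebra.antipode ℂ).rTensor A t)) := by
  induction t with
  | zero => simp
  | add s t hs ht => simp only [map_add, hs, ht, mul_add, Finset.sum_add_distrib]
  | tmul a b =>
    simp only [deltaHom_tmul, map_sum, LinearMap.rTensor_tmul, LinearMap.comp_apply,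
      AlgHom.toLinearMap_apply, LinearMap.mul'_apply, LinearEquiv.coe_coe,
      MulOpposite.coe_opLinearEquiv_symm, map_mul, antipodeHom_nu, antipodeHom_P,
      MulOpposite.unop_mul, MulOpposite.unop_op]
    refine Finset.sum_congr rfl fun k _ => ?_
    simp only [nu_comm, Finset.mul_sum, ← mul_assoc, isMagic_P.col_orth]
    simp [mul_assoc]

lemma antipode_right_nu (i : Fin N) (t : A ⊗[ℂ] A) :
    LinearMap.mul' ℂ (OWreath K N) (((MulOpposite.opLinearEquiv ℂ).symm.toLinearMap ∘ₗ
      (antipodeHom K N).toLinearMap).lTensor (OWreath K N) (deltaHom K i t)) =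
    nu K i (LinearMap.mul' ℂ A ((HopfAlgebra.antipode ℂ).lTensor A t)) := by
  induction t with
  | zero => simp
  | add s t hs ht => simp only [map_add, hs, ht]
  | tmul a b =>
    simp only [deltaHom_tmul, map_sum, LinearMap.lTensor_tmul, LinearMap.comp_apply,
      AlgHom.toLinearMap_apply, LinearMap.mul'_apply, LinearEquiv.coe_coe,
      MulOpposite.coe_opLinearEquiv_symm, map_mul, antipodeHom_nu,
      MulOpposite.unop_op]
    have h : ∀ k, nu K i a * P K i k * ∑ l, nu K l (HopfAlgebra.antipode ℂ b) * P K l k =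
        nu K i a * (P K i k * nu K i (HopfAlgebra.antipode ℂ b)) := by
      intro k
      simp only [nu_comm _ _ (HopfAlgebra.antipode ℂ b), mul_assoc, Finset.mul_sum]
      simp only [← mul_assoc (P K i k), isMagic_P.col_orth]
      simp
    simp only [h]
    rw [← Finset.mul_sum, ← Finset.sum_mul, isMagic_P.row_sum, one_mul]

instance : HopfAlgebra ℂ (OWreath K N) :=
  hopfOfAntiHom (antipodeHom K N) _ adjoin_generators
    (by
      rintro _ (⟨⟨i, x⟩, rfl⟩ | ⟨⟨i, j⟩, rfl⟩)
      · simp only [comul_nu, counit_nu]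
        rw [antipode_left_nu, HopfAlgebra.mul_antipode_rTensor_comul_apply]
        simp only [AlgHom.commutes]
        rw [← Finset.sum_mul, isMagic_P.col_sum, one_mul]
      · simp only [comul_P, counit_P, map_sum, LinearMap.rTensor_tmul,
          LinearMap.comp_apply, AlgHom.toLinearMap_apply, antipodeHom_P, LinearMap.mul'_apply]
        simp only [LinearEquiv.coe_coe, MulOpposite.coe_opLinearEquiv_symm, MulOpposite.unop_op,
          isMagic_P.row_orth]
        by_cases h : i = j
        · simp [h, isMagic_P.col_sum]
        · simp [h])
    (by
      rintro _ (⟨⟨i, x⟩, rfl⟩ | ⟨⟨i, j⟩, rfl⟩)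
      · simp only [comul_nu, counit_nu]
        rw [antipode_right_nu, HopfAlgebra.mul_antipode_lTensor_comul_apply, AlgHom.commutes]
      · simp only [comul_P, counit_P, map_sum, LinearMap.lTensor_tmul,
          LinearMap.comp_apply, AlgHom.toLinearMap_apply, antipodeHom_P, LinearMap.mul'_apply]
        simp only [LinearEquiv.coe_coe, MulOpposite.coe_opLinearEquiv_symm, MulOpposite.unop_op,
          isMagic_P.col_orth]
        by_cases h : i = j
        · simp [h, isMagic_P.row_sum]
        · simp [h])

/-! ### The CQG-algebra structure -/

lemma deltaHom_star [HopfStarAlgebra A] (i : Fin N) (t : A ⊗[ℂ] A) :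
    deltaHom K i (star t) = star (deltaHom K i t) := by
  induction t with
  | zero => simp
  | add s t hs ht => simp only [star_add, map_add, hs, ht]
  | tmul a b => simp [deltaHom_tmul, star_nu, star_P, nu_comm]

instance [HopfStarAlgebra A] : HopfStarAlgebra (OWreath K N) :=
  hopfStarOfAdjoin _ adjoin_generators (by
    rintro _ (⟨⟨i, x⟩, rfl⟩ | ⟨⟨i, j⟩, rfl⟩)
    · simp only [star_nu, comul_nu, HopfStarAlgebra.comul_star, deltaHom_star]
    · simp [star_P, comul_P])

lemma P_mem_matrixCoefficients [HopfStarAlgebra A] (i j : Fin N) :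
    P K i j ∈ matrixCoefficients (OWreath K N) := by
  have : IsUnitaryCorep (fun i j => P K i j : Matrix (Fin N) (Fin N) (OWreath K N)) := by
    refine ⟨(isUnitaryCorep_iff_sums _).2 ⟨fun i j => ?_, fun i j => ?_⟩, comul_P⟩
    · by_cases h : i = j
      · simp [star_P, isMagic_P.row_orth, h, isMagic_P.col_sum]
      · simp [star_P, isMagic_P.row_orth, h]
    · by_cases h : i = j
      · simp [star_P, isMagic_P.col_orth, h, isMagic_P.row_sum]
      · simp [star_P, isMagic_P.col_orth, h]
  exact this.mem_matrixCoefficients i j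

lemma isUnitaryCorep_nu_mul_P [HopfStarAlgebra A] {n : Type*} [Fintype n] [DecidableEq n]
    {u : Matrix n n A} (hu : IsUnitaryCorep u) :
    IsUnitaryCorep (fun a b => nu K a.1 (u a.2 b.2) * P K a.1 b.1 :
      Matrix (Fin N × n) (Fin N × n) (OWreath K N)) := by
  have h := (isUnitaryCorep_iff_sums u).1 hu.unitary
  refine ⟨(isUnitaryCorep_iff_sums _).2 ⟨?_, ?_⟩, ?_⟩
  · rintro ⟨j, b⟩ ⟨l, c⟩
    have key : ∀ i : Fin N, ∑ a, star (nu K i (u a b) * P K i j) * (nu K i (u a c) * P K i l) =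
        nu K i (∑ a, star (u a b) * u a c) * (P K i j * P K i l) := by
      intro i
      rw [map_sum, Finset.sum_mul]
      refine Finset.sum_congr rfl fun a _ => ?_
      rw [star_mul, star_nu, star_P, ← nu_comm, map_mul, mul_assoc, mul_assoc,
        ← mul_assoc (P K i j), ← nu_comm, mul_assoc]
    rw [Fintype.sum_prod_type]
    simp only [key, h.1, isMagic_P.row_orth]
    by_cases hb : b = c
    · by_cases hj : j = l
      · simp [hb, hj, isMagic_P.col_sum]
      · simp [hj]
    · simp [hb]
  · rintro ⟨i, a⟩ ⟨k, c⟩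
    have key : ∀ j : Fin N, ∑ b, (nu K i (u a b) * P K i j) * star (nu K k (u c b) * P K k j) =
        if i = k then nu K i (∑ b, u a b * star (u c b)) * P K i j else 0 := by
      intro j
      by_cases hik : i = k
      · subst hik
        rw [if_pos rfl, map_sum, Finset.sum_mul]
        refine Finset.sum_congr rfl fun b _ => ?_
        rw [star_mul, star_nu, star_P, mul_assoc, ← mul_assoc (P K i j), isMagic_P.row_orth,
          if_pos rfl, ← nu_comm, map_mul, mul_assoc]
      · rw [if_neg hik]
        refine Finset.sum_eq_zero fun b _ => ?_
        rw [star_mul, star_nu, star_P, mul_assoc, ← mul_assoc (P K i j), isMagic_P.col_orth,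
          if_neg hik, zero_mul, mul_zero]
    rw [Fintype.sum_prod_type]
    simp only [key, h.2]
    by_cases hi : i = k
    · by_cases ha : a = c
      · simp [hi, ha, isMagic_P.row_sum]
      · simp [ha]
    · simp [hi]
  · rintro ⟨i, a⟩ ⟨j, b⟩
    simp only [Bialgebra.comul_mul, comul_nu, comul_P, hu.comul, map_sum, deltaHom_tmul]
    rw [Finset.sum_comm, Finset.sum_mul, Fintype.sum_prod_type]
    refine Finset.sum_congr rfl fun k _ => ?_
    rw [Finset.sum_mul]
    refine Finset.sum_congr rfl fun c _ => ?_
    simp only [Finset.mul_sum, Algebra.TensorProduct.tmul_mul_tmul, mul_assoc, isMagic_P.row_orth]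
    simp [TensorProduct.ite_tmul]

instance [CQGAlgebra A] : CQGAlgebra (OWreath K N) :=
  cqgOfAdjoin _ adjoin_generators (by
    rintro _ (⟨⟨i, x⟩, rfl⟩ | ⟨⟨i, j⟩, rfl⟩)
    · have hx : x ∈ Submodule.span ℂ (matrixCoefficients A) :=
        CQGAlgebra.span_matrixCoefficients (A := A) ▸ Submodule.mem_top
      change nu K i x ∈ _
      induction hx using Submodule.span_induction with
      | mem x hx =>
        obtain ⟨d, u, hu, a, b, rfl⟩ := hx
        have : nu K i (u a b) = ∑ j, nu K i (u a b) * P K i j := by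
          rw [← Finset.mul_sum, isMagic_P.row_sum, mul_one]
        rw [this]
        exact sum_mem fun j _ => Submodule.subset_span
          ((isUnitaryCorep_nu_mul_P (K := K) hu).mem_matrixCoefficients (i, a) (j, b))
      | zero => simp
      | add x y _ _ hx hy => rw [map_add]; exact add_mem hx hy
      | smul c x _ hx => rw [map_smul]; exact Submodule.smul_mem _ _ hx
    · exact Submodule.subset_span (P_mem_matrixCoefficients i j))

end OWreath

/-- The CQG-algebra of the free wreath product `G ≀_* S_N^+`, where `A = O(G)`: the quotient of the
free product of `N` copies of `A` and `O(S_N^+)` by the relations `[ν i x, p i j] = 0`. -/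
abbrev OFreeWreath (A : Type*) [Ring A] [StarRing A] [HopfAlgebra ℂ A] (N : ℕ) : Type _ :=
  OWreath (HopfStarSubset.empty A) N

/-- The CQG-algebra of the free wreath product `G ≀_{*,H} S_N^+` with amalgamation over a dual
quantum subgroup `H` of `G`, where `A = O(G)` and `B = O(H)`: the quotient of the free product of
`N` copies of `A`, amalgamated over `B`, and of `O(S_N^+)` by the relations `[ν i x, p i j] = 0`. -/
abbrev OAmalgFreeWreath {A B : Type*} [Ring A] [StarRing A] [HopfAlgebra ℂ A] [CQGAlgebra A]
    [Ring B] [StarRing B] [HopfAlgebra ℂ B] [CQGAlgebra B] (H : DualQuantumSubgroup B A) (N : ℕ) :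
    Type _ :=
  OWreath H.image N

end Wreath

end QuantumWreath

end

open QuantumWreath

/-! All the algebras involved are given by generators and relations, and the whole statement rests
on two generator-preserving homomorphisms, both obtained from the universal property `OWreath.lift`.

The first, `mapAlgHom`, fixes every `ν i x` and every `p i j` and changes only the set that is
amalgamated. It exists as soon as the identifications demanded by the source already hold in the
target, and it is surjective because its range contains the generators. Starting from the empty set
nothing is demanded, so the free wreath product maps onto every amalgamated one. Starting from the
scalars the demand is met for free, because each `ν i` is unital and hence `ν i (c 1) = c 1` for
every `i`. The maps in the two directions are then inverse to each other, which settles the trivial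
dual quantum subgroup.

The second, `tensorAlgHom`, sends `ν i x` to `x ⊗ 1` and `p i j` to `1 ⊗ p i j`. It forgets `i`, so
it respects any amalgamation, and the two tensor legs commute. It is compatible with coproducts
because the `N` terms of `Δ (ν i x)` differ in the image only by the factors `p i k`, whose sum over
`k` is `1` (`map_tensorAlgHom_deltaHom`). This gives the direct product as a quantum subgroup.

When all of `O(G)` is amalgamated, there is a single copy `ν` of it. The relations `[ν i x, p i j] =
0`, for all `i`, then say that this copy commutes with every `p k l`, hence with all of `O(S_N^+)`
(`nu_commute_sigma`). So `a ⊗ y ↦ ν a * σ y` is a well-defined homomorphism and inverts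
`tensorAlgHom` (`injective_tensorAlgHom`).

Counits, coproducts and involutions are compared on generators only. Antipodes need no check, as a
bialgebra homomorphism between Hopf algebras preserves them. -/

namespace QuantumWreath

namespace OWreath

variable {A : Type*} [Ring A] [StarRing A] [HopfAlgebra ℂ A] {N : ℕ}

/-! ### Changing the amalgamation -/

section Map
variable (K L : HopfStarSubset A) (h : ∀ i j : Fin N, ∀ x ∈ K.carrier, nu L i x = nu L j x)

/-- The homomorphism `OWreath K N → OWreath L N` preserving the generators, which exists as soon as
the elements of `K` are amalgamated in `OWreath L N`. -/
noncomputable def mapAlgHom : OWreath K N →ₐ[ℂ] OWreath L N :=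
  lift (nu L) (sigma L N) h nu_comm

@[simp] lemma mapAlgHom_nu (i : Fin N) (x : A) : mapAlgHom K L h (nu K i x) = nu L i x :=
  lift_nu _ _ _ _ i x

@[simp] lemma mapAlgHom_P (i j : Fin N) : mapAlgHom K L h (P K i j) = P L i j :=
  lift_P _ _ _ _ i j

/-- `deltaHom` is written with `ν` and `p` alone, and these are preserved. Since `Δ (ν i x)` is
`deltaHom` applied to `Δ x`, this is the compatibility of `mapAlgHom` with coproducts on `ν i x`. An
arbitrary tensor `t` stands for `Δ x`, which is not a pure tensor in general, so that the check
reduces by additivity to pure tensors. -/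
lemma map_deltaHom (i : Fin N) (t : A ⊗[ℂ] A) :
    Algebra.TensorProduct.map (mapAlgHom K L h) (mapAlgHom K L h) (deltaHom K i t) =
      deltaHom L i t := by
  induction t with
  | zero => simp
  | add s t hs ht => simp only [map_add, hs, ht]
  | tmul a b => simp [deltaHom_tmul]

/-- The Hopf algebra homomorphism `OWreath K N → OWreath L N` preserving the generators. -/
noncomputable def mapHom : OWreath K N →ₐc[ℂ] OWreath L N :=
  BialgHom.ofAlgHom (mapAlgHom K L h)
    (hom_ext
      (fun i x => by
        change Coalgebra.counit (R := ℂ) (mapAlgHom K L h (nu K i x)) =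
          Coalgebra.counit (R := ℂ) (nu K i x)
        rw [mapAlgHom_nu, counit_nu, counit_nu])
      (fun i j => by
        change Coalgebra.counit (R := ℂ) (mapAlgHom K L h (P K i j)) =
          Coalgebra.counit (R := ℂ) (P K i j)
        rw [mapAlgHom_P, counit_P, counit_P]))
    (hom_ext
      (fun i x => by
        simp only [AlgHom.comp_apply, Bialgebra.comulAlgHom_apply, mapAlgHom_nu, comul_nu,
          map_deltaHom])
      (fun i j => by
        simp only [AlgHom.comp_apply, Bialgebra.comulAlgHom_apply, mapAlgHom_P, comul_P, map_sum,
          Algebra.TensorProduct.map_tmul]))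

lemma surjective_mapAlgHom : Function.Surjective (mapAlgHom K L h) := by
  rw [← AlgHom.range_eq_top, eq_top_iff, ← adjoin_generators (K := L)]
  refine Algebra.adjoin_le ?_
  rintro _ (⟨⟨i, x⟩, rfl⟩ | ⟨⟨i, j⟩, rfl⟩)
  · exact ⟨nu K i x, mapAlgHom_nu K L h i x⟩
  · exact ⟨P K i j, mapAlgHom_P K L h i j⟩

/-- The composite fixes the generators, so it is the identity. The hypotheses `h` and `h'` together
say that amalgamating `K` or amalgamating `L` imposes the same identifications. The lemma is applied
with the scalars and the empty set. -/
lemma mapAlgHom_mapAlgHom (h' : ∀ i j : Fin N, ∀ x ∈ L.carrier, nu K i x = nu K j x)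
    (x : OWreath K N) : mapAlgHom L K h' (mapAlgHom K L h x) = x := by
  have : (mapAlgHom L K h').comp (mapAlgHom K L h) = AlgHom.id ℂ _ :=
    hom_ext (fun i x => by simp) (fun i j => by simp)
  exact DFunLike.congr_fun this x

end Map

/-! ### Compatibility with the involutions -/

/-- An algebra homomorphism from `OWreath K N` which is compatible with the involutions on the
generators is a `*`-homomorphism. -/
lemma map_star_of_generators [HopfStarAlgebra A] {K : HopfStarSubset A} {B : Type*} [Ring B]
    [StarRing B] [Algebra ℂ B] [StarModule ℂ B] (f : OWreath K N →ₐ[ℂ] B)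
    (hn : ∀ i x, f (nu K i (star x)) = star (f (nu K i x)))
    (hp : ∀ i j, f (P K i j) = star (f (P K i j))) (x : OWreath K N) :
    f (star x) = star (f x) := by
  have hx : x ∈ Algebra.adjoin ℂ (generators K N) := by
    rw [adjoin_generators]; exact Algebra.mem_top
  -- Both `x ↦ f (star x)` and `x ↦ star (f x)` are conjugate-linear and antimultiplicative, so the
  -- set where they agree is a subalgebra. On `p i j`, which is self-adjoint, agreement means that
  -- the image is self-adjoint.
  induction hx using Algebra.adjoin_induction with
  | mem x hx =>
    obtain ⟨⟨i, x⟩, rfl⟩ | ⟨⟨i, j⟩, rfl⟩ := hx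
    · rw [star_nu, hn]
    · rw [star_P, ← hp]
  | algebraMap c => simp only [← algebraMap_star_comm, AlgHom.commutes]
  | add x y _ _ hx hy => simp only [star_add, map_add, hx, hy]
  | mul x y _ _ hx hy => simp only [star_mul, map_mul, hx, hy]

lemma mapHom_star [HopfStarAlgebra A] (K L : HopfStarSubset A)
    (h : ∀ i j : Fin N, ∀ x ∈ K.carrier, nu L i x = nu L j x) (x : OWreath K N) :
    mapHom K L h (star x) = star (mapHom K L h x) :=
  map_star_of_generators (mapAlgHom K L h) (by simp [star_nu]) (by simp [star_P]) x

/-! ### The homomorphism to the direct product -/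

section Tensor
variable (K : HopfStarSubset A)

/-- The homomorphism `ν i x ↦ x ⊗ 1`, `p i j ↦ 1 ⊗ p i j`. -/
noncomputable def tensorAlgHom (N : ℕ) : OWreath K N →ₐ[ℂ] A ⊗[ℂ] OSPlus N :=
  lift (fun _ => Algebra.TensorProduct.includeLeft) Algebra.TensorProduct.includeRight
    -- The map on the `i`-th copy does not depend on `i`, so every identification between copies
    -- holds by definition, whatever `K` is. The commutation relation is that of the two tensor
    -- legs.
    (fun _ _ _ _ => rfl) (fun i j x => by simp)

@[simp] lemma tensorAlgHom_nu (i : Fin N) (x : A) :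
    tensorAlgHom K N (nu K i x) = x ⊗ₜ[ℂ] 1 :=
  lift_nu _ _ _ _ i x

@[simp] lemma tensorAlgHom_sigma (y : OSPlus N) :
    tensorAlgHom K N (sigma K N y) = 1 ⊗ₜ[ℂ] y :=
  lift_sigma _ _ _ _ y

@[simp] lemma tensorAlgHom_P (i j : Fin N) :
    tensorAlgHom K N (P K i j) = 1 ⊗ₜ[ℂ] OSPlus.p i j :=
  tensorAlgHom_sigma K _

/-- This is where the twisted coproduct of the wreath product becomes the untwisted one of the
direct product. All the `ν k b` have the same image `b ⊗ 1`, so the sum over `k` falls on the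
factors `p i k` alone, and the row sum of a magic unitary is `1`. In particular the result no longer
depends on `i`. -/
lemma map_tensorAlgHom_deltaHom (i : Fin N) (t : A ⊗[ℂ] A) :
    Algebra.TensorProduct.map (tensorAlgHom K N) (tensorAlgHom K N) (deltaHom K i t) =
      Algebra.TensorProduct.map
        (Algebra.TensorProduct.includeLeft : A →ₐ[ℂ] A ⊗[ℂ] OSPlus N)
        (Algebra.TensorProduct.includeLeft : A →ₐ[ℂ] A ⊗[ℂ] OSPlus N) t := by
  induction t with
  | zero => simp
  | add s t hs ht => simp only [map_add, hs, ht]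
  | tmul a b =>
    simp only [deltaHom_tmul, map_sum, Algebra.TensorProduct.map_tmul, map_mul, tensorAlgHom_nu,
      tensorAlgHom_P, Algebra.TensorProduct.tmul_mul_tmul, mul_one, one_mul,
      Algebra.TensorProduct.includeLeft_apply]
    rw [← TensorProduct.sum_tmul, ← TensorProduct.tmul_sum, OSPlus.isMagic_p.row_sum]

/-- The Hopf algebra homomorphism `ν i x ↦ x ⊗ 1`, `p i j ↦ 1 ⊗ p i j`. -/
noncomputable def tensorHom (N : ℕ) : OWreath K N →ₐc[ℂ] A ⊗[ℂ] OSPlus N :=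
  BialgHom.ofAlgHom (tensorAlgHom K N)
    (hom_ext
      (fun i x => by
        change Coalgebra.counit (R := ℂ) (tensorAlgHom K N (nu K i x)) =
          Coalgebra.counit (R := ℂ) (nu K i x)
        rw [tensorAlgHom_nu, counit_nu, TensorProduct.counit_tmul, Bialgebra.counit_one, one_smul])
      (fun i j => by
        change Coalgebra.counit (R := ℂ) (tensorAlgHom K N (P K i j)) =
          Coalgebra.counit (R := ℂ) (P K i j)
        rw [tensorAlgHom_P, counit_P, TensorProduct.counit_tmul, Bialgebra.counit_one,
          OSPlus.counit_p, smul_eq_mul, mul_one]))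
    (hom_ext
      (fun i x => by
        simp only [AlgHom.comp_apply, Bialgebra.comulAlgHom_apply, tensorAlgHom_nu, comul_nu,
          map_tensorAlgHom_deltaHom, comul_tmul_one])
      (fun i j => by
        simp only [AlgHom.comp_apply, Bialgebra.comulAlgHom_apply, tensorAlgHom_P, comul_P,
          comul_one_tmul, OSPlus.comul_p, map_sum, Algebra.TensorProduct.map_tmul,
          Algebra.TensorProduct.includeRight_apply]))

lemma tensorHom_star [HopfStarAlgebra A] (x : OWreath K N) :
    tensorHom K N (star x) = star (tensorHom K N x) :=
  map_star_of_generators (tensorAlgHom K N) (by simp) (by simp) x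

/-- One copy of `A` and the copy of `O(S_N^+)` already hit both tensor legs, which generate. An
index `0 : Fin N` is indispensable: for `N = 0` there are no generators at all, the source is
spanned by the unit, and `a ⊗ 1` is missed unless `a` is a scalar. -/
lemma surjective_tensorAlgHom [NeZero N] : Function.Surjective (tensorAlgHom K N) := by
  rw [← AlgHom.range_eq_top, eq_top_iff, ← adjoin_tensor]
  refine Algebra.adjoin_le ?_
  rintro _ (⟨a, rfl⟩ | ⟨y, rfl⟩)
  · exact ⟨nu K 0 a, tensorAlgHom_nu K 0 a⟩
  · exact ⟨sigma K N y, tensorAlgHom_sigma K y⟩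

/-! ### Full amalgamation: inverting the homomorphism to the direct product -/

variable {K}

/-- The defining relations only make `ν i x` commute with the `i`-th row of `p`. If `x` is
amalgamated, it may be moved to the copy whose index is the row of any given `p k l`, so it commutes
with all the generators of `O(S_N^+)`, hence with the algebra they generate. -/
lemma nu_commute_sigma (hK : ∀ x, x ∈ K.carrier) (i : Fin N) (x : A) (y : OSPlus N) :
    Commute (nu K i x) (sigma K N y) := by
  have hy : y ∈ Algebra.adjoin ℂ (Set.range (fun ij : Fin N × Fin N => OSPlus.p ij.1 ij.2)) :=
    OSPlus.adjoin_p ▸ Algebra.mem_top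
  induction hy using Algebra.adjoin_induction with
  | mem y hy =>
    obtain ⟨⟨k, l⟩, rfl⟩ := hy
    rw [nu_amalg i k (hK x)]
    exact nu_comm k l x
  | algebraMap c => rw [AlgHom.commutes]; exact Algebra.commute_algebraMap_right c _
  | add y z _ _ hy hz => rw [map_add]; exact hy.add_right hz
  | mul y z _ _ hy hz => rw [map_mul]; exact hy.mul_right hz

/-- The left inverse is `a ⊗ y ↦ ν 0 a * σ y`, multiplicative because the two factors commute under
full amalgamation. The choice of the copy `0` is immaterial, all copies being equal. -/
lemma injective_tensorAlgHom [NeZero N] (hK : ∀ x, x ∈ K.carrier) :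
    Function.Injective (tensorAlgHom K N) := by
  let g : A ⊗[ℂ] OSPlus N →ₐ[ℂ] OWreath K N :=
    Algebra.TensorProduct.lift (nu K 0) (sigma K N) (nu_commute_sigma hK 0)
  -- On `ν i x` the composite gives `ν 0 x`, which equals `ν i x` by amalgamation; on `p i j` it is
  -- the identity directly.
  have : g.comp (tensorAlgHom K N) = AlgHom.id ℂ _ :=
    hom_ext (fun i x => by simpa [g] using nu_amalg 0 i (hK x)) (fun i j => by simp [g, P])
  exact Function.LeftInverse.injective (g := g) (DFunLike.congr_fun this)

end Tensor

end OWreath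

end QuantumWreath

/-! ### The two quantum subgroups and the two extreme cases -/

open QuantumWreath
theorem mainTheorem12 {A B : Type*}
    [Ring A] [StarRing A] [HopfAlgebra ℂ A] [CQGAlgebra A]
    [Ring B] [StarRing B] [HopfAlgebra ℂ B] [CQGAlgebra B]
    (H : DualQuantumSubgroup B A) (N : ℕ) (hN : 1 ≤ N) :
    IsQuantumSubgroup (A ⊗[ℂ] OSPlus N) (OAmalgFreeWreath H N) ∧
    IsQuantumSubgroup (OAmalgFreeWreath H N) (OFreeWreath A N) ∧
    IsIsomorphic (OAmalgFreeWreath (DualQuantumSubgroup.self A) N) (A ⊗[ℂ] OSPlus N) ∧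
    IsIsomorphic (OAmalgFreeWreath (DualQuantumSubgroup.trivial A) N) (OFreeWreath A N) := by
  have : NeZero N := ⟨by omega⟩
  have hE (L : HopfStarSubset A) : ∀ i j : Fin N, ∀ x ∈ (HopfStarSubset.empty A).carrier,
      OWreath.nu L i x = OWreath.nu L j x := fun _ _ _ hx => hx.elim
  -- The trivial dual quantum subgroup amalgamates only scalars, and these are identified even in
  -- the free wreath product without amalgamation, since every `ν i` is a unital algebra
  -- homomorphism.
  have hT : ∀ i j : Fin N, ∀ x ∈ (DualQuantumSubgroup.trivial A).image.carrier,
      OWreath.nu (HopfStarSubset.empty A) i x = OWreath.nu (HopfStarSubset.empty A) j x := by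
    rintro i j _ ⟨c, rfl⟩
    change OWreath.nu _ i (algebraMap ℂ A c) = OWreath.nu _ j (algebraMap ℂ A c)
    rw [AlgHom.commutes, AlgHom.commutes]
  -- A quantum subgroup is a surjection out of the larger group's algebra, so the arrows run from
  -- the free wreath product to the amalgamated one to the tensor product. In the third item the
  -- image of `DualQuantumSubgroup.self` is all of `A`, with `x` as its own preimage. In the fourth
  -- the left inverse is the map in the opposite direction, given by `hE`.
  refine ⟨⟨OWreath.tensorHom _ N, OWreath.tensorHom_star _, OWreath.surjective_tensorAlgHom _⟩,
    ⟨OWreath.mapHom _ _ (hE _), OWreath.mapHom_star _ _ _, OWreath.surjective_mapAlgHom _ _ _⟩,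
    ⟨OWreath.tensorHom _ N, OWreath.tensorHom_star _,
      OWreath.injective_tensorAlgHom fun x => ⟨x, rfl⟩, OWreath.surjective_tensorAlgHom _⟩,
    ⟨OWreath.mapHom _ _ hT, OWreath.mapHom_star _ _ _,
      Function.LeftInverse.injective (OWreath.mapAlgHom_mapAlgHom _ _ _ (hE _)),
      OWreath.surjective_mapAlgHom _ _ _⟩⟩
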